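/- Let $(X,d)$ be a complete separable metric space and let $E:X\to\mathbb R\cup\{+\infty\}$ be lower semicontinuous, with dense domain $D(E)=\{E<\infty\}$, and bounded from below on every bounded subset of $X$. Let $\lambda\in\mathbb R$ and suppose that every $x\in X$ is the starting point of an $\mathrm{EVI}_\lambda$-gradient flow of $E$, i.e. of a curve $(\eta_t)_{t>0}$ in $AC_{loc}((0,\infty),X)$ with $\eta_t\to x$ as $t\downarrow0$ such that, for every $y\in X$, $$\tfrac12\tfrac{\mathrm d}{\mathrm dt}d^2(\eta_t,y)+\tfrac\lambda2 d^2(\eta_t,y)+E(\eta_t)\le E(y)\qquad\text{for a.e. }t>0 .$$ Such a flow is unique; write $S_tx:=\eta_t$ for $t>0$ and $S_0x:=x$. For an absolutely continuous curve $\gamma$ let $|\dot\gamma_t|=\lim_{s\to t}d(\gamma_s,\gamma_t)/|s-t|$ (which exists for a.e. $t$) be its metric speed, and say $\gamma\in AC^2([0,1],X)$ if $\gamma$ is absolutely continuous on $[0,1]$ and $|\dot\gamma|\in L^2(0,1)$. Let $|\partial E|(x)=\limsup_{y\to x}[E(x)-E(y)]^+/d(x,y)$ for $x\in D(E)$ (with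 value $0$ if $x$ is isolated) and $|\partial E|(x)=+\infty$ for $x\notin D(E)$ be the slope of $E$, and put $\lambda^-=\max\{-\lambda,0\}$. Let $\varepsilon>0$, let $\gamma\in AC^2([0,1],X)$ satisfy $E(\gamma_0),E(\gamma_1)<\infty$, and define $$\gamma^\varepsilon_t:=S_{\varepsilon\min\{t,1-t\}}\gamma_t,\qquad t\in[0,1].$$ Then $\gamma^\varepsilon\in AC^2([0,1],X)$, the function $t\mapsto E(\gamma^\varepsilon_t)$ is finite and absolutely continuous on $[0,1]$, $t\mapsto|\partial E|(\gamma^\varepsilon_t)$ belongs to $L^2(0,1)$, and $$\frac12\int_0^1|\dot\gamma^\varepsilon_t|^2\,\mathrm dt+\frac{\varepsilon^2}2\int_0^1|\partial E|^2(\gamma^\varepsilon_t)\,\mathrm dt\le\frac12e^{\lambda^-\varepsilon}\int_0^1|\dot\gamma_t|^2\,\mathrm dt-2\varepsilon E(\gamma^\varepsilon_{1/2})+\varepsilon\big(E(\gamma_0)+E(\gamma_1)\big).$$ -/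

import Mathlib

open MeasureTheory Filter Topology
open scoped ENNReal

noncomputable section

/-- The proper domain `D(E) = {E < +∞}` of a functional with values in `(-∞, +∞]`. -/
def energyDomain {X : Type*} (E : X → EReal) : Set X := {x | E x < ⊤}

/-- The metric speed `|γ̇_t| = lim_{s → t} d(γ_s, γ_t) / |s - t|`, written as an upper limit so that
it is defined at every `t`; for absolutely continuous curves the limit exists at almost every
time. -/
def metricSpeed {X : Type*} [MetricSpace X] (γ : ℝ → X) (t : ℝ) : ℝ≥0∞ :=
  limsup (fun s : ℝ => edist (γ s) (γ t) / edist s t) (𝓝[≠] t)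

/-- `γ ∈ AC²([0,1], X)`: absolutely continuous on `[0,1]` with metric speed in `L²(0,1)`.
Only the values of `γ` on `[0,1]` matter. -/
def IsAC2 {X : Type*} [MetricSpace X] (γ : ℝ → X) : Prop :=
  AbsolutelyContinuousOnInterval γ 0 1 ∧
    MemLp (metricSpeed γ) 2 (volume.restrict (Set.Ioo (0 : ℝ) 1))

/-- The descending slope `|∂E|(x) = limsup_{y → x} [E(x) - E(y)]⁺ / d(x,y)` for `x ∈ D(E)`, and `+∞`
outside `D(E)`. At an isolated point of `X` the filter `𝓝[≠] x` is trivial and the upper limit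
is `0`. -/
def metricSlope {X : Type*} [MetricSpace X] (E : X → EReal) (x : X) : ℝ≥0∞ :=
  open Classical in
  if x ∈ energyDomain E then
    limsup (fun y : X => (E x - E y).toENNReal / edist x y) (𝓝[≠] x)
  else ⊤

/-- `(η_t)_{t>0}` is a gradient flow of `E` in the `EVI_lam` sense: `η ∈ AC_loc((0,∞), X)` and
`½ d/dt d²(η_t, y) + (lam/2) d²(η_t, y) + E(η_t) ≤ E(y)` for all `y` and almost every `t > 0`. Only
the values of `η` on `(0,∞)` matter. -/
structure IsEVIFlow {X : Type*} [MetricSpace X] (E : X → EReal) (lam : ℝ) (η : ℝ → X) : Prop where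
  locally_ac : ∀ a b : ℝ, 0 < a → a ≤ b → AbsolutelyContinuousOnInterval η a b
  evi : ∀ y : X, ∀ᵐ t ∂(volume.restrict (Set.Ioi (0 : ℝ))),
    (((1 / 2) * deriv (fun s : ℝ => dist (η s) y ^ 2) t + (lam / 2) * dist (η t) y ^ 2 : ℝ) : EReal)
      + E (η t) ≤ E y

/-- `η` is an `EVI_lam` gradient flow of `E` starting at `x ∈ closure D(E)`. -/
structure IsEVIFlowFrom {X : Type*} [MetricSpace X] (E : X → EReal) (lam : ℝ) (x : X)
    (η : ℝ → X) : Prop where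
  isEVIFlow : IsEVIFlow E lam η
  mem_closure : x ∈ closure (energyDomain E)
  tendsto : Tendsto η (𝓝[>] 0) (𝓝 x)

/-- The semigroup `S_t x` of the `EVI_lam` flow of `E`: `S_0 x = x` and, for `t > 0`, `S_t x = η_t`
where `η` is the `EVI_lam` gradient flow starting at `x` (which is unique on `(0,∞)` when it
exists). For `t ≤ 0`, or if there is no such flow, the value is `x`. -/
def eviSemigroup {X : Type*} [MetricSpace X] (E : X → EReal) (lam : ℝ) (t : ℝ) (x : X) : X :=
  open Classical in
  if h : 0 < t ∧ ∃ η : ℝ → X, IsEVIFlowFrom E lam x η then h.2.choose t else x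

/-- The standing assumptions on `E : X → (-∞, +∞]` and `lam ∈ ℝ`: `E` is lower semicontinuous, has
dense domain, is bounded from below on bounded sets, and every point of `X` is the starting point
of an `EVI_lam` gradient flow of `E`. -/
structure EVISetting {X : Type*} [MetricSpace X] (E : X → EReal) (lam : ℝ) : Prop where
  ne_bot : ∀ x, E x ≠ ⊥
  lsc : LowerSemicontinuous E
  dense_domain : Dense (energyDomain E)
  bddBelow_of_isBounded : ∀ B : Set X, Bornology.IsBounded B →
    ∃ c : ℝ, ∀ x ∈ B, (c : EReal) ≤ E x
  exists_flow : ∀ x : X, ∃ η : ℝ → X, IsEVIFlowFrom E lam x η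

/-- The regularized curve `γ^ε_t = S_{ε min(t, 1 - t)} γ_t`. -/
def regularizedCurve {X : Type*} [MetricSpace X] (E : X → EReal) (lam ε : ℝ) (γ : ℝ → X) :
    ℝ → X :=
  fun t => eviSemigroup E lam (ε * min t (1 - t)) (γ t)

end

/-! ### Absolutely continuous curves and their metric speed -/

/-! On the first half write β_t = S_{εt}γ_t and, for s < t, h = ε(t - s). The integrated inequality
for the flow issuing from γ_t, between the times εs and εt and tested at y = β_s, bounds
½e^{λh}d²(β_s,β_t) + (∫₀ʰ e^{λr}dr)(E(β_t) - E(β_s)) by ½d²(S_{εs}γ_t, S_{εs}γ_s). By contraction of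
the flow this is at most ½e^{-2λεs}d²(γ_s,γ_t). The inequality also leaves room for the energy
dissipated between εs and εt. Since E(S_r x) - E(S_b x) is at least about |∂E|²(S_b x)(b - r), a
further term close to ½h²|∂E|²(β_t) fits on the left. This is `flowedCurve_two_point`.

Dividing by (t - s)² and letting the two times merge gives, at almost every t in [0,T], ½|β̇|² +
ε(E∘β)' + (ε²/2)|∂E|²(β) ≤ ½e^{2λ⁻εT}|γ̇|² (`sq_add_sq_le_of_lt`). Integration over T = 1/2, applied
to γ and to its reversal, yields the two halves of the claim (`flowedCurve_estimate`); the factor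
becomes e^{λ⁻ε}, and the energies at time 1/2 add up.

The integration requires E∘β to be absolutely continuous up to t = 0, where the slope is not
controlled. For t ≥ δ the flow regularizes: the slope is bounded, so E is Lipschitz along β and the
two-point estimate makes β absolutely continuous. Near 0 there is only the one-sided bound E(β_t) -
E(β_s) ≤ C∫_s^t|γ̇|². It makes C∫_0^t|γ̇|² - E(β_t) nondecreasing, and a monotone function
continuous at 0 and absolutely continuous on every [δ,T] is so on [0,T]
(`absolutelyContinuousOnInterval_energy`).

The facts about single flows are monotonicity and right continuity of the energy, the contraction
`IsIntegralEVIFlow.dist_le`, and the dissipation bound `IsIntegralEVIFlow.le_dissipation`. -/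

lemma absolutelyContinuousOnInterval_of_dist_le {Y Z : Type*} [PseudoMetricSpace Y]
    [PseudoMetricSpace Z] {f : ℝ → Y} {g : ℝ → Z} {a b : ℝ}
    (hg : AbsolutelyContinuousOnInterval g a b) (A B : ℝ)
    (h : ∀ s ∈ Set.uIcc a b, ∀ t ∈ Set.uIcc a b,
      dist (f s) (f t) ≤ A * dist (g s) (g t) + B * dist s t) :
    AbsolutelyContinuousOnInterval f a b := by
  have hid : AbsolutelyContinuousOnInterval (fun x : ℝ => x) a b :=
    (LipschitzWith.id.lipschitzOnWith (s := Set.uIcc a b)).absolutelyContinuousOnInterval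
  have hlim : Tendsto (fun J : ℕ × (ℕ → ℝ × ℝ) =>
      A * (∑ i ∈ Finset.range J.1, dist (g (J.2 i).1) (g (J.2 i).2))
        + B * ∑ i ∈ Finset.range J.1, dist (J.2 i).1 (J.2 i).2)
      (AbsolutelyContinuousOnInterval.totalLengthFilter ⊓
        𝓟 (AbsolutelyContinuousOnInterval.disjWithin a b)) (𝓝 0) := by
    simpa using (Tendsto.const_mul A hg).add (Tendsto.const_mul B hid)
  refine squeeze_zero' (Eventually.of_forall fun J => Finset.sum_nonneg fun i _ => dist_nonneg)
    ?_ hlim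
  have hmem : ∀ᶠ J in (AbsolutelyContinuousOnInterval.totalLengthFilter ⊓
      𝓟 (AbsolutelyContinuousOnInterval.disjWithin a b)),
      J ∈ AbsolutelyContinuousOnInterval.disjWithin a b :=
    mem_inf_of_right (mem_principal_self _)
  filter_upwards [hmem] with J hJ
  rw [Finset.mul_sum, Finset.mul_sum, ← Finset.sum_add_distrib]
  exact Finset.sum_le_sum fun i hi => h _ (hJ.1 i hi).1 _ (hJ.1 i hi).2

lemma AbsolutelyContinuousOnInterval.dist_const {Y : Type*} [PseudoMetricSpace Y] {f : ℝ → Y}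
    {a b : ℝ} (hf : AbsolutelyContinuousOnInterval f a b) (y : Y) :
    AbsolutelyContinuousOnInterval (fun t => dist (f t) y) a b :=
  absolutelyContinuousOnInterval_of_dist_le hf 1 0 fun s _ t _ => by
    simpa [Real.dist_eq] using abs_dist_sub_le (f s) (f t) y

lemma AbsolutelyContinuousOnInterval.continuousOn_Icc {Y : Type*} [PseudoMetricSpace Y] {f : ℝ → Y}
    {a b : ℝ} (hf : AbsolutelyContinuousOnInterval f a b) (hab : a ≤ b) :
    ContinuousOn f (Set.Icc a b) := by
  intro t ht
  rw [← Set.uIcc_of_le hab] at ht ⊢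
  have h := (hf.dist_const (f t)).continuousOn t ht
  rw [ContinuousWithinAt, dist_self] at h
  exact tendsto_iff_dist_tendsto_zero.2 h

/-- The primitive of `m` is absolutely continuous and its increments dominate those of `f`. -/
lemma absolutelyContinuousOnInterval_of_dist_le_integral {Y : Type*} [PseudoMetricSpace Y]
    {f : ℝ → Y} {m : ℝ → ℝ} {a b : ℝ} (hab : a ≤ b) (hm : IntervalIntegrable m volume a b)
    (h : ∀ s t, a ≤ s → s ≤ t → t ≤ b → dist (f s) (f t) ≤ ∫ r in s..t, m r) :
    AbsolutelyContinuousOnInterval f a b := by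
  have hg := hm.absolutelyContinuousOnInterval_intervalIntegral (c := a) Set.left_mem_uIcc
  have key : ∀ s t, a ≤ s → s ≤ t → t ≤ b →
      dist (f s) (f t) ≤ dist (∫ v in a..s, m v) (∫ v in a..t, m v) := by
    intro s t has hst htb
    have h1 : IntervalIntegrable m volume a s :=
      hm.mono_set (by rw [Set.uIcc_of_le has, Set.uIcc_of_le hab]
                      exact Set.Icc_subset_Icc_right (hst.trans htb))
    have h2 : IntervalIntegrable m volume a t :=
      hm.mono_set (by rw [Set.uIcc_of_le (has.trans hst), Set.uIcc_of_le hab]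
                      exact Set.Icc_subset_Icc_right htb)
    rw [dist_comm (∫ v in a..s, m v), Real.dist_eq,
      intervalIntegral.integral_interval_sub_left h2 h1]
    exact (h s t has hst htb).trans (le_abs_self _)
  refine absolutelyContinuousOnInterval_of_dist_le hg 1 0 fun s hs t ht => ?_
  rw [Set.uIcc_of_le hab] at hs ht
  rw [one_mul, zero_mul, add_zero]
  rcases le_total s t with hst | hst
  · exact key s t hs.1 hst ht.2
  · rw [dist_comm, dist_comm (∫ v in a..s, m v)]
    exact key t s ht.1 hst hs.2

/-- A continuous representative of a curve that is continuous on an interval. -/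
lemma continuous_comp_projIcc {Y : Type*} [TopologicalSpace Y] {f : ℝ → Y} {a b : ℝ} (hab : a ≤ b)
    (hf : ContinuousOn f (Set.Icc a b)) :
    Continuous fun t : ℝ => f (Set.projIcc a b hab t) :=
  hf.comp_continuous (continuous_subtype_val.comp continuous_projIcc) fun t => (Set.projIcc a b hab t).2

lemma metricSpeed_congr {X : Type*} [MetricSpace X] {γ γ' : ℝ → X} {t : ℝ} (h : γ =ᶠ[𝓝 t] γ') :
    metricSpeed γ t = metricSpeed γ' t := by
  refine limsup_congr ?_
  filter_upwards [h.filter_mono nhdsWithin_le_nhds] with s hs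
  rw [hs, h.eq_of_nhds]

/-- Needed to treat the second half of a curve as the first half of its reversal. -/
lemma metricSpeed_comp_const_sub {X : Type*} [MetricSpace X] (γ : ℝ → X) (c t : ℝ) :
    metricSpeed (fun s => γ (c - s)) t = metricSpeed γ (c - t) := by
  have hmap : map (fun s : ℝ => c - s) (𝓝[≠] t) = 𝓝[≠] (c - t) := by
    have h := (Homeomorph.subLeft c).isEmbedding.map_nhdsWithin_eq {t}ᶜ t
    simp only [Homeomorph.coe_subLeft] at h
    rw [h]
    congr 1
    ext x
    simp only [Set.mem_image, Set.mem_compl_iff, Set.mem_singleton_iff]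
    exact ⟨fun ⟨y, hy, hyx⟩ hx => hy (by linarith), fun hx => ⟨c - x, fun h => hx (by linarith),
      by ring⟩⟩
  unfold metricSpeed
  rw [← hmap, limsup, limsup, map_map]
  congr 2
  ext s
  simp only [Function.comp, edist_dist]
  rw [show dist (c - s) (c - t) = dist s t from dist_sub_left c s t]

/-- Local upper difference quotients of a kernel which is lower semicontinuous in its first
variable are Borel functions. -/
lemma measurable_limsup_div_edist {Y : Type*} [MetricSpace Y] [MeasurableSpace Y] [BorelSpace Y]
    {A : Y → Y → ℝ≥0∞} (hA : ∀ y, LowerSemicontinuous fun x => A x y) :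
    Measurable fun x => limsup (fun y => A x y / edist x y) (𝓝[≠] x) := by
  -- Symmetry of balls lets the constraint be read as one on `x` for fixed `y`. Each quotient is
  -- then lower semicontinuous and cut off to an open set, so the supremum over all `y`, even
  -- uncountable, stays lower semicontinuous; only the infimum over radii is left, and it is
  -- countable.
  have hrep : (fun x => limsup (fun y => A x y / edist x y) (𝓝[≠] x)) = fun x =>
      ⨅ n : ℕ, ⨆ y : Y, (Metric.ball y (1 / ((n : ℝ) + 1)) ∩ {y}ᶜ).indicator
        (fun x => A x y / edist x y) x := by
    ext x
    rw [(nhdsWithin_hasBasis (Metric.nhds_basis_ball_inv_nat_succ (x := x)) _).limsup_eq_iInf_iSup]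
    simp only [iInf_true]
    refine iInf_congr fun n => ?_
    refine le_antisymm ?_ ?_
    · refine iSup₂_le fun y hy => ?_
      refine le_iSup_of_le y ?_
      rw [Set.indicator_of_mem]
      exact ⟨Metric.mem_ball_comm.1 hy.1, fun h => hy.2 (by simpa using h.symm)⟩
    · refine iSup_le fun y => ?_
      by_cases hy : x ∈ Metric.ball y (1 / ((n : ℝ) + 1)) ∩ {y}ᶜ
      · rw [Set.indicator_of_mem hy]
        exact le_iSup₂_of_le (f := fun (i : Y)
            (_ : i ∈ Metric.ball x (1 / ((n : ℝ) + 1)) ∩ {x}ᶜ) => A x i / edist x i) y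
          ⟨Metric.mem_ball_comm.1 hy.1, fun h => hy.2 (by simpa using h.symm)⟩ le_rfl
      · rw [Set.indicator_of_notMem hy]; exact bot_le
  rw [hrep]
  refine Measurable.iInf fun n => LowerSemicontinuous.measurable ?_
  refine lowerSemicontinuous_iSup fun y x c hc => ?_
  change c < Set.indicator _ _ _ at hc
  change ∀ᶠ z in 𝓝 x, c < Set.indicator _ _ z
  by_cases hx : x ∈ Metric.ball y (1 / ((n : ℝ) + 1)) ∩ {y}ᶜ
  · have hopen : IsOpen (Metric.ball y (1 / ((n : ℝ) + 1)) ∩ {y}ᶜ) :=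
      Metric.isOpen_ball.inter isOpen_compl_singleton
    rw [Set.indicator_of_mem hx] at hc
    have hct : c ≠ ∞ := hc.ne_top
    have hxy : edist x y ≠ 0 := fun h => hx.2 (by simpa using edist_eq_zero.1 h)
    rw [ENNReal.lt_div_iff_mul_lt (Or.inl hxy) (Or.inl (edist_ne_top x y))] at hc
    obtain ⟨c', h1, h2⟩ := exists_between hc
    have hcont : Continuous fun z : Y => c * edist z y :=
      (ENNReal.continuous_const_mul hct).comp (continuous_id.edist continuous_const)
    filter_upwards [hopen.mem_nhds hx, hA y x c' h2, hcont.continuousAt.eventually (gt_mem_nhds h1)]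
      with z hz h3 h4
    rw [Set.indicator_of_mem hz]
    have hzy : edist z y ≠ 0 := fun h => hz.2 (by simpa using edist_eq_zero.1 h)
    rw [ENNReal.lt_div_iff_mul_lt (Or.inl hzy) (Or.inl (edist_ne_top z y))]
    exact h4.trans h3
  · rw [Set.indicator_of_notMem hx] at hc
    exact absurd hc not_lt_zero

lemma measurable_metricSpeed {X : Type*} [MetricSpace X] {γ : ℝ → X} (hγ : Continuous γ) :
    Measurable (metricSpeed γ) := by
  have h := measurable_limsup_div_edist (A := fun t s : ℝ => edist (γ s) (γ t)) fun s =>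
    (continuous_const.edist hγ).lowerSemicontinuous
  unfold metricSpeed
  simpa only [edist_comm] using h

lemma aemeasurable_metricSpeed {X : Type*} [MetricSpace X] {γ : ℝ → X} {a b : ℝ} (hab : a ≤ b)
    (hγ : ContinuousOn γ (Set.Icc a b)) :
    AEMeasurable (metricSpeed γ) (volume.restrict (Set.Ioo a b)) := by
  refine ⟨_, measurable_metricSpeed (continuous_comp_projIcc hab hγ), ?_⟩
  filter_upwards [ae_restrict_mem measurableSet_Ioo] with t ht
  refine metricSpeed_congr ?_
  filter_upwards [isOpen_Ioo.mem_nhds ht] with s hs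
  rw [Set.projIcc_of_mem hab (Set.Ioo_subset_Icc_self hs)]

lemma enorm_deriv_le_metricSpeed {X : Type*} [MetricSpace X] {γ : ℝ → X} {f : ℝ → ℝ} {t : ℝ}
    (hf : DifferentiableAt ℝ f t) (h : ∀ᶠ s in 𝓝 t, edist (f s) (f t) ≤ edist (γ s) (γ t)) :
    ‖deriv f t‖ₑ ≤ metricSpeed γ t := by
  have h1 : Tendsto (fun s => ‖slope f t s‖ₑ) (𝓝[≠] t) (𝓝 ‖deriv f t‖ₑ) :=
    (hasDerivAt_iff_tendsto_slope.1 hf.hasDerivAt).enorm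
  rw [← h1.limsup_eq]
  refine limsup_le_limsup ?_
  filter_upwards [h.filter_mono nhdsWithin_le_nhds, self_mem_nhdsWithin] with s hs hst
  have hst' : s - t ≠ 0 := sub_ne_zero.2 hst
  rw [slope_def_field, edist_eq_enorm_sub s t, div_eq_mul_inv, enorm_mul, enorm_inv hst',
    ← div_eq_mul_inv, ← edist_eq_enorm_sub]
  gcongr

/-- The length of an absolutely continuous curve bounds the distance of its endpoints. -/
lemma edist_le_lintegral_metricSpeed {X : Type*} [MetricSpace X] {γ : ℝ → X} {s t : ℝ}
    (hst : s ≤ t) (hγ : AbsolutelyContinuousOnInterval γ s t) :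
    edist (γ s) (γ t) ≤ ∫⁻ r in Set.Ioo s t, metricSpeed γ r := by
  -- The fundamental theorem of calculus is applied to the real function d(γ_r, γ_s), whose
  -- derivative is at most the metric speed.
  have hf : AbsolutelyContinuousOnInterval (fun r => dist (γ r) (γ s)) s t :=
    hγ.dist_const (γ s)
  have h1 := hf.integral_deriv_eq_sub
  rw [dist_self, sub_zero] at h1
  calc edist (γ s) (γ t) = ‖∫ r in s..t, deriv (fun r => dist (γ r) (γ s)) r‖ₑ := by
        rw [h1, edist_comm, edist_dist, Real.enorm_of_nonneg dist_nonneg]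
    _ ≤ ∫⁻ r in Set.Ioc s t, ‖deriv (fun r => dist (γ r) (γ s)) r‖ₑ := by
        rw [intervalIntegral.integral_of_le hst]
        exact enorm_integral_le_lintegral_enorm _
    _ ≤ ∫⁻ r in Set.Ioc s t, metricSpeed γ r := by
        refine lintegral_mono_ae ?_
        rw [ae_restrict_iff' measurableSet_Ioc]
        filter_upwards [hf.ae_differentiableAt] with r hr hrs
        refine enorm_deriv_le_metricSpeed (hr (by
          rw [Set.uIcc_of_le hst]; exact Set.Ioc_subset_Icc_self hrs)) (Eventually.of_forall ?_)
        intro a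
        rw [edist_dist, edist_dist]
        exact ENNReal.ofReal_le_ofReal (abs_dist_sub_le _ _ _)
    _ = ∫⁻ r in Set.Ioo s t, metricSpeed γ r := by
        rw [setLIntegral_congr Ioo_ae_eq_Ioc]

/-- Cauchy–Schwarz for the length of a curve. -/
lemma edist_sq_le_lintegral_metricSpeed_sq {X : Type*} [MetricSpace X] {γ : ℝ → X} {s t : ℝ}
    (hst : s ≤ t) (hγ : AbsolutelyContinuousOnInterval γ s t) :
    edist (γ s) (γ t) ^ 2 ≤
      ENNReal.ofReal (t - s) * ∫⁻ r in Set.Ioo s t, metricSpeed γ r ^ 2 := by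
  have hm := aemeasurable_metricSpeed hst (hγ.continuousOn_Icc hst)
  have h2 : ∫⁻ r in Set.Ioo s t, metricSpeed γ r ≤
      (∫⁻ r in Set.Ioo s t, metricSpeed γ r ^ (2 : ℕ)) ^ (1 / 2 : ℝ)
        * (ENNReal.ofReal (t - s)) ^ (1 / 2 : ℝ) := by
    have h := ENNReal.lintegral_mul_le_Lp_mul_Lq (volume.restrict (Set.Ioo s t))
      (f := metricSpeed γ) (g := fun _ => 1) Real.HolderConjugate.two_two hm aemeasurable_const
    have h1 : (2 : ℝ) = ((2 : ℕ) : ℝ) := by norm_num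
    simp only [Pi.mul_apply, mul_one, ENNReal.one_rpow, lintegral_const, Measure.restrict_apply_univ,
      Real.volume_Ioo, one_mul] at h
    rw [h1] at h
    simp only [ENNReal.rpow_natCast] at h
    exact h
  calc edist (γ s) (γ t) ^ 2 ≤ ((∫⁻ r in Set.Ioo s t, metricSpeed γ r ^ (2 : ℕ)) ^ (1 / 2 : ℝ)
        * (ENNReal.ofReal (t - s)) ^ (1 / 2 : ℝ)) ^ 2 := by
        gcongr; exact (edist_le_lintegral_metricSpeed hst hγ).trans h2
    _ = _ := by
        rw [mul_pow, ← ENNReal.rpow_natCast, ← ENNReal.rpow_natCast, ← ENNReal.rpow_mul,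
          ← ENNReal.rpow_mul, mul_comm]
        norm_num

/-- For fixed `y` the kernel is 0 if `E y = ⊤`, and otherwise a continuous nondecreasing function of
`E x`, hence lower semicontinuous in `x`. -/
lemma measurable_limsup_toENNReal_sub_div {X : Type*} [MetricSpace X]
    [MeasurableSpace X] [BorelSpace X] {E : X → EReal} (hE : LowerSemicontinuous E) (hbot : ∀ x, E x ≠ ⊥) :
    Measurable fun x : X => limsup (fun y : X => (E x - E y).toENNReal / edist x y) (𝓝[≠] x) := by
  refine measurable_limsup_div_edist fun y => ?_
  by_cases hy : E y = ⊤
  · simp only [hy, EReal.sub_top, EReal.toENNReal_bot]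
    exact lowerSemicontinuous_const
  · lift E y to ℝ using ⟨hy, hbot y⟩ with c
    refine Continuous.comp_lowerSemicontinuous (g := fun z : EReal => (z - c).toENNReal) ?_ hE ?_
    · refine EReal.continuous_toENNReal.comp ?_
      exact continuous_iff_continuousAt.2 fun z => (EReal.continuousAt_add
        (Or.inr (by simp)) (Or.inr (by simp))).comp
        (f := fun z : EReal => (z, -(c : EReal))) (continuous_id.prodMk continuous_const).continuousAt
    · intro a b hab
      exact EReal.toENNReal_le_toENNReal (EReal.sub_le_sub hab le_rfl)

/-! ### Integrated evolution variational inequalities -/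

lemma IsEVIFlow.ae_real {X : Type*} [MetricSpace X] {E : X → EReal} {lam : ℝ} {η : ℝ → X}
    (hbot : ∀ x, E x ≠ ⊥) (h : IsEVIFlow E lam η) {y : X} (hy : E y < ⊤) :
    ∀ᵐ t : ℝ, 0 < t → E (η t) < ⊤ ∧
      (1 / 2) * deriv (fun s : ℝ => dist (η s) y ^ 2) t + (lam / 2) * dist (η t) y ^ 2
        + (E (η t)).toReal ≤ (E y).toReal := by
  have h1 := h.evi y
  rw [ae_restrict_iff' measurableSet_Ioi] at h1
  filter_upwards [h1] with t ht h0
  have h2 := ht h0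
  have h3 : E (η t) < ⊤ := by
    by_contra hcon
    rw [not_lt_top_iff.1 hcon, EReal.coe_add_top] at h2
    exact absurd hy (not_lt.2 h2)
  refine ⟨h3, ?_⟩
  rw [← EReal.coe_toReal h3.ne (hbot _), ← EReal.coe_toReal hy.ne (hbot _)] at h2
  exact_mod_cast h2

/-- Along a curve on which `E` is almost everywhere finite, the energy is locally integrable and
the differential inequality may be integrated. -/
lemma IsEVIFlow.integral_evi {X : Type*} [MetricSpace X] {E : X → EReal} {lam : ℝ} {η : ℝ → X}
    (hE : EVISetting E lam) (h : IsEVIFlow E lam η) {y : X} (hy : E y < ⊤) {s t : ℝ} (hs : 0 < s)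
    (hst : s ≤ t) :
    IntervalIntegrable (fun r => (E (η r)).toReal) volume s t ∧
    Real.exp (lam * (t - s)) / 2 * dist (η t) y ^ 2 - dist (η s) y ^ 2 / 2 ≤
      ∫ r in s..t, Real.exp (lam * (r - s)) * ((E y).toReal - (E (η r)).toReal) := by
  have hac := h.locally_ac s t hs hst
  have hcont := hac.continuousOn_Icc hst
  have hd2 : AbsolutelyContinuousOnInterval (fun r => dist (η r) y ^ 2) s t := by
    simpa only [pow_two] using (hac.dist_const y).fun_mul (hac.dist_const y)
  have hexp : AbsolutelyContinuousOnInterval (fun r => Real.exp (lam * (r - s)) / 2) s t :=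
    ContDiffOn.absolutelyContinuousOnInterval (by fun_prop)
  have hψ := hexp.fun_mul hd2
  have hae := h.ae_real hE.ne_bot hy
  have hderiv : ∀ᵐ r : ℝ, r ∈ Set.uIcc s t →
      deriv (fun r => Real.exp (lam * (r - s)) / 2 * dist (η r) y ^ 2) r =
        Real.exp (lam * (r - s)) * ((1 / 2) * deriv (fun s : ℝ => dist (η s) y ^ 2) r
          + (lam / 2) * dist (η r) y ^ 2) := by
    filter_upwards [hd2.ae_differentiableAt] with r hr hrs
    have h1 : HasDerivAt (fun r => Real.exp (lam * (r - s)) / 2)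
        (Real.exp (lam * (r - s)) * (lam * 1) / 2) r :=
      ((((hasDerivAt_id r).sub_const s).const_mul lam).exp).div_const 2
    rw [(h1.fun_mul (hr hrs).hasDerivAt).deriv]
    ring
  -- The energy lies between a constant, since the image of [s,t] is bounded, and the integrable
  -- function obtained by solving the differential inequality for `E (η r)`.
  have hint : IntervalIntegrable (fun r => (E (η r)).toReal) volume s t := by
    rw [intervalIntegrable_iff, Set.uIoc_of_le hst]
    obtain ⟨c, hc⟩ := hE.bddBelow_of_isBounded (η '' Set.Icc s t)
      (isCompact_Icc.image_of_continuousOn hcont).isBounded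
    have hup : IntervalIntegrable (fun r => (E y).toReal
        - ((1 / 2) * deriv (fun s : ℝ => dist (η s) y ^ 2) r + (lam / 2) * dist (η r) y ^ 2))
        volume s t := by
      refine intervalIntegrable_const.sub ((hd2.intervalIntegrable_deriv.const_mul _).add
        (ContinuousOn.intervalIntegrable ?_))
      exact hd2.continuousOn.const_mul _
    rw [intervalIntegrable_iff, Set.uIoc_of_le hst] at hup
    have hmeas : AEStronglyMeasurable (fun r => (E (η r)).toReal)
        (volume.restrict (Set.Ioc s t)) := by
      have hm : Measurable fun r => (E (η (Set.projIcc s t hst r))).toReal :=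
        measurable_ereal_toReal.comp
          ((hE.lsc.comp (continuous_comp_projIcc hst hcont)).measurable)
      refine ⟨_, hm.stronglyMeasurable, ?_⟩
      filter_upwards [ae_restrict_mem measurableSet_Ioc] with r hr
      rw [Set.projIcc_of_mem hst (Set.Ioc_subset_Icc_self hr)]
    refine (hup.norm.add (integrable_const |c|)).mono' hmeas ?_
    rw [ae_restrict_iff' measurableSet_Ioc]
    filter_upwards [hae] with r hr hrs
    obtain ⟨h1, h2⟩ := hr (hs.trans hrs.1)
    have h3 : c ≤ (E (η r)).toReal := by
      have := hc _ (Set.mem_image_of_mem η (Set.Ioc_subset_Icc_self hrs))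
      rw [← EReal.coe_toReal h1.ne (hE.ne_bot _)] at this
      exact_mod_cast this
    simp only [Pi.add_apply]
    rw [Real.norm_eq_abs, Real.norm_eq_abs, abs_le]
    constructor
    · have := neg_abs_le c
      have := abs_nonneg ((E y).toReal
        - ((1 / 2) * deriv (fun s : ℝ => dist (η s) y ^ 2) r + (lam / 2) * dist (η r) y ^ 2))
      linarith
    · have := abs_nonneg c
      have := le_abs_self ((E y).toReal
        - ((1 / 2) * deriv (fun s : ℝ => dist (η s) y ^ 2) r + (lam / 2) * dist (η r) y ^ 2))
      linarith
  refine ⟨hint, ?_⟩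
  have h1 := hψ.integral_deriv_eq_sub
  simp only [sub_self, mul_zero, Real.exp_zero] at h1
  calc _ = ∫ r in s..t, deriv (fun r => Real.exp (lam * (r - s)) / 2 * dist (η r) y ^ 2) r := by
        rw [h1]; ring
    _ ≤ _ := by
        refine intervalIntegral.integral_mono_ae_restrict hst hψ.intervalIntegrable_deriv ?_ ?_
        · exact (intervalIntegrable_const.sub hint).continuousOn_mul
            (Continuous.continuousOn (by fun_prop))
        · rw [EventuallyLE, ae_restrict_iff' measurableSet_Icc]
          filter_upwards [hae, hderiv] with r hr hr' hrs
          rw [hr' (by rwa [Set.uIcc_of_le hst])]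
          have := (hr (hs.trans_le hrs.1)).2
          gcongr
          linarith

/-- The energy decreases along `EVI` flows, and is finite at positive times. -/
lemma IsEVIFlow.antitoneOn {X : Type*} [MetricSpace X] {E : X → EReal} {lam : ℝ} {η : ℝ → X}
    (hE : EVISetting E lam) (h : IsEVIFlow E lam η) :
    AntitoneOn (fun t => E (η t)) (Set.Ioi 0) := by
  intro s hs t ht hst
  by_contra hcon
  simp only [not_le] at hcon
  obtain ⟨c, hc1, hc2⟩ := exists_between hcon
  have hs0 : 0 < s := hs
  have hcont := (h.locally_ac s t hs0 hst).continuousOn_Icc hst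
  -- Lower semicontinuity makes this set compact, so there is a last time σ with energy at most c.
  -- After σ the energy exceeds c ≥ E(η_σ), which contradicts the integrated inequality on [σ,t]
  -- tested at η_σ.
  set A : Set ℝ := Set.Icc s t ∩ {r | E (η r) ≤ c} with hA
  have hclosed : IsClosed A := by
    have : A = Set.Icc s t ∩ {r | E (η (Set.projIcc s t hst r)) ≤ c} := by
      ext r
      refine and_congr_right fun hr => ?_
      simp only [Set.mem_ofPred_eq]
      rw [Set.projIcc_of_mem hst hr]
    rw [this]
    exact isClosed_Icc.inter
      ((hE.lsc.comp (continuous_comp_projIcc hst hcont)).isClosed_preimage c)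
  have hcomp : IsCompact A := isCompact_Icc.of_isClosed_subset hclosed Set.inter_subset_left
  have hne : A.Nonempty := ⟨s, Set.left_mem_Icc.2 hst, hc1.le⟩
  have hmem := hcomp.sSup_mem hne
  set σ := sSup A
  have hlt : σ < t := lt_of_le_of_ne hmem.1.2 fun heq => by
    have := hmem.2
    rw [heq] at this
    exact absurd hc2 (not_lt.2 this)
  have hσ0 : 0 < σ := hs0.trans_le hmem.1.1
  have hEσ : E (η σ) < ⊤ := lt_of_le_of_lt hmem.2 (hc2.trans_le le_top)
  have hgt : ∀ r ∈ Set.Ioc σ t, c < E (η r) := by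
    intro r hr
    by_contra hrc
    have : r ≤ σ := le_csSup hcomp.bddAbove ⟨⟨hmem.1.1.trans hr.1.le, hr.2⟩, not_lt.1 hrc⟩
    exact absurd hr.1 (not_lt.2 this)
  obtain ⟨hint, hineq⟩ := h.integral_evi hE hEσ hσ0 hlt.le
  set f : ℝ → ℝ := fun r => Real.exp (lam * (r - σ)) * ((E (η r)).toReal - (E (η σ)).toReal)
  have hfint : IntervalIntegrable f volume σ t :=
    (hint.sub intervalIntegrable_const).continuousOn_mul (Continuous.continuousOn (by fun_prop))
  have hfpos : ∀ᵐ r ∂volume.restrict (Set.Ioc σ t), 0 < f r := by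
    rw [ae_restrict_iff' measurableSet_Ioc]
    filter_upwards [h.ae_real hE.ne_bot hEσ] with r hr hrs
    have h1 := (hr (hσ0.trans hrs.1)).1
    have h2 : E (η σ) < E (η r) := lt_of_le_of_lt hmem.2 (hgt r hrs)
    have h3 : (E (η σ)).toReal < (E (η r)).toReal := by
      rwa [← EReal.coe_toReal hEσ.ne (hE.ne_bot _), ← EReal.coe_toReal h1.ne (hE.ne_bot _),
        EReal.coe_lt_coe_iff] at h2
    exact mul_pos (Real.exp_pos _) (sub_pos.2 h3)
  have hint0 : ∫ r in σ..t, f r ≤ 0 := by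
    have h1 : ∫ r in σ..t, f r = - ∫ r in σ..t,
        Real.exp (lam * (r - σ)) * ((E (η σ)).toReal - (E (η r)).toReal) := by
      rw [← intervalIntegral.integral_neg]
      refine intervalIntegral.integral_congr fun r _ => ?_
      simp only [f]; ring
    rw [h1, neg_nonpos]
    refine le_trans ?_ hineq
    rw [dist_self]
    have := Real.exp_pos (lam * (t - σ))
    have : 0 ≤ Real.exp (lam * (t - σ)) / 2 * dist (η t) (η σ) ^ 2 := by positivity
    linarith
  rw [intervalIntegral.integral_of_le hlt.le] at hint0
  have h0 : ∫ r in Set.Ioc σ t, f r = 0 :=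
    le_antisymm hint0 (integral_nonneg_of_ae (hfpos.mono fun _ h => h.le))
  rw [integral_eq_zero_iff_of_nonneg_ae (hfpos.mono fun _ h => h.le)
    ((intervalIntegrable_iff_integrableOn_Ioc_of_le hlt.le).1 hfint)] at h0
  have hfalse : ∀ᵐ r ∂volume.restrict (Set.Ioc σ t), False := by
    filter_upwards [h0, hfpos] with r h1 h2
    exact h2.ne' h1
  rw [eventually_false_iff_eq_bot, ae_eq_bot, Measure.restrict_eq_zero, Real.volume_Ioc,
    ENNReal.ofReal_eq_zero] at hfalse
  linarith

/-- The inequality tested at one point of the domain forces finiteness at almost every time;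
monotonicity carries it from an earlier time to `t`. -/
lemma IsEVIFlow.lt_top {X : Type*} [MetricSpace X] {E : X → EReal} {lam : ℝ} {η : ℝ → X}
    (hE : EVISetting E lam) (h : IsEVIFlow E lam η) {t : ℝ} (ht : 0 < t) : E (η t) < ⊤ := by
  obtain ⟨y, hy⟩ : (energyDomain E).Nonempty := by
    have := hE.dense_domain.nonempty_iff.2 ⟨η 0⟩
    exact this
  have h1 := h.ae_real hE.ne_bot hy
  obtain ⟨s, hs, hst⟩ : ∃ s ∈ Set.Ioo 0 t, E (η s) < ⊤ := by
    by_contra hcon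
    push Not at hcon
    have : ∀ᵐ r ∂volume.restrict (Set.Ioo 0 t), False := by
      rw [ae_restrict_iff' measurableSet_Ioo]
      filter_upwards [h1] with r hr hrs
      exact absurd (hr hrs.1).1 (not_lt.2 (hcon r hrs))
    rw [eventually_false_iff_eq_bot, ae_eq_bot, Measure.restrict_eq_zero, Real.volume_Ioo,
      ENNReal.ofReal_eq_zero] at this
    linarith
  exact lt_of_le_of_lt (h.antitoneOn hE hs.1 ht hs.2.le) hst

/-- `∫₀ʰ e^{lam r} dr`. -/
noncomputable def expIntegral (lam h : ℝ) : ℝ := ∫ r in (0 : ℝ)..h, Real.exp (lam * r)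

lemma hasDerivAt_expIntegral (lam h : ℝ) :
    HasDerivAt (expIntegral lam) (Real.exp (lam * h)) h :=
  (Continuous.deriv_integral (f := fun r => Real.exp (lam * r)) (by fun_prop) 0 h) ▸
    ((intervalIntegral.integral_hasDerivAt_right
      (Continuous.intervalIntegrable (by fun_prop) _ _)
      (Continuous.stronglyMeasurableAtFilter (by fun_prop) _ _)
      (Continuous.continuousAt (by fun_prop))).differentiableAt.hasDerivAt)

lemma continuous_expIntegral (lam : ℝ) : Continuous (expIntegral lam) :=
  continuous_iff_continuousAt.2 fun h => (hasDerivAt_expIntegral lam h).continuousAt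

@[simp] lemma expIntegral_zero (lam : ℝ) : expIntegral lam 0 = 0 := by simp [expIntegral]

lemma expIntegral_pos (lam : ℝ) {h : ℝ} (hh : 0 < h) : 0 < expIntegral lam h :=
  intervalIntegral.intervalIntegral_pos_of_pos (Continuous.intervalIntegrable (by fun_prop) _ _)
    (fun _ => Real.exp_pos _) hh

lemma tendsto_expIntegral_div (lam : ℝ) :
    Tendsto (fun h => expIntegral lam h / h) (𝓝[>] 0) (𝓝 1) := by
  have h := hasDerivAt_iff_tendsto_slope.1 (hasDerivAt_expIntegral lam 0)
  have h' := h.mono_left (nhdsWithin_mono (0 : ℝ) fun x (hx : x ∈ Set.Ioi (0 : ℝ)) =>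
    (Set.mem_compl_singleton_iff.2 (ne_of_gt hx)))
  simpa [slope_fun_def_field] using h'

lemma neg_abs_mul_le_mul (lam : ℝ) {r h : ℝ} (hr : 0 ≤ r) (hrh : r ≤ h) :
    -(|lam| * h) ≤ lam * r ∧ lam * r ≤ |lam| * h := by
  have h1 := neg_abs_le lam
  have h2 := le_abs_self lam
  have h3 := abs_nonneg lam
  constructor <;> nlinarith

lemma exp_neg_mul_le_expIntegral (lam : ℝ) {h : ℝ} (hh : 0 ≤ h) :
    Real.exp (-(|lam| * h)) * h ≤ expIntegral lam h := by
  have h1 : ∫ _ in (0 : ℝ)..h, Real.exp (-(|lam| * h)) ≤ expIntegral lam h := by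
    refine intervalIntegral.integral_mono_on hh intervalIntegrable_const
      (Continuous.intervalIntegrable (by fun_prop) _ _) fun r hr => ?_
    exact Real.exp_le_exp.2 (neg_abs_mul_le_mul lam hr.1 hr.2).1
  simpa [mul_comm] using h1

lemma expIntegral_le (lam : ℝ) {h : ℝ} (hh : 0 ≤ h) :
    expIntegral lam h ≤ Real.exp (|lam| * h) * h := by
  have h1 : expIntegral lam h ≤ ∫ _ in (0 : ℝ)..h, Real.exp (|lam| * h) := by
    refine intervalIntegral.integral_mono_on hh
      (Continuous.intervalIntegrable (by fun_prop) _ _) intervalIntegrable_const fun r hr => ?_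
    exact Real.exp_le_exp.2 (neg_abs_mul_le_mul lam hr.1 hr.2).2
  simpa [mul_comm] using h1

/-- A continuous curve on `[0, ∞)` along which the energy is finite and decreasing at positive
times, and which satisfies the time-integrated evolution variational inequality. -/
structure IsIntegralEVIFlow {X : Type*} [MetricSpace X] (E : X → EReal) (lam : ℝ) (η : ℝ → X) :
    Prop where
  continuousOn : ContinuousOn η (Set.Ici 0)
  lt_top : ∀ t, 0 < t → E (η t) < ⊤
  antitoneOn : AntitoneOn (fun t => E (η t)) (Set.Ioi 0)
  integral_evi : ∀ y s t, 0 < s → s ≤ t → E y < ⊤ →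
    Real.exp (lam * (t - s)) / 2 * dist (η t) y ^ 2 - dist (η s) y ^ 2 / 2 ≤
      ∫ r in s..t, Real.exp (lam * (r - s)) * ((E y).toReal - (E (η r)).toReal)

/-! ### Consequences of the integrated inequality: energy monotonicity, right continuity,
contraction. -/

namespace IsIntegralEVIFlow

variable {X : Type*} [MetricSpace X] {E : X → EReal} {lam : ℝ} {η ξ : ℝ → X}

lemma toReal_antitoneOn (hbot : ∀ x, E x ≠ ⊥) (h : IsIntegralEVIFlow E lam η) :
    AntitoneOn (fun t => (E (η t)).toReal) (Set.Ioi 0) := fun s hs _ ht hst =>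
  EReal.toReal_le_toReal (h.antitoneOn hs ht hst) (hbot _) (h.lt_top s hs).ne

lemma intervalIntegrable (hbot : ∀ x, E x ≠ ⊥) (h : IsIntegralEVIFlow E lam η) {s t : ℝ}
    (hs : 0 < s) (hst : s ≤ t) : IntervalIntegrable (fun r => (E (η r)).toReal) volume s t :=
  AntitoneOn.intervalIntegrable ((h.toReal_antitoneOn hbot).mono (by
    rw [Set.uIcc_of_le hst]; exact fun r hr => hs.trans_le hr.1))

/-- Transfers statements about time 0 to any later time, and allows a flow to be compared with its
own delay through `dist_le`. -/
lemma shift (h : IsIntegralEVIFlow E lam η) {a : ℝ} (ha : 0 ≤ a) :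
    IsIntegralEVIFlow E lam (fun t => η (a + t)) where
  continuousOn := h.continuousOn.comp (Continuous.continuousOn (by fun_prop))
    fun t (ht : 0 ≤ t) => Set.mem_Ici.2 (add_nonneg ha ht)
  lt_top t ht := h.lt_top _ (by linarith)
  antitoneOn s hs t ht hst := h.antitoneOn (Set.mem_Ioi.2 (add_pos_of_nonneg_of_pos ha hs))
    (Set.mem_Ioi.2 (add_pos_of_nonneg_of_pos ha ht)) (by linarith)
  integral_evi y s t hs hst hy := by
    have h1 := h.integral_evi y (a + s) (a + t) (by linarith) (by linarith) hy
    have h2 := intervalIntegral.integral_comp_add_left (a := s) (b := t)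
      (fun r => Real.exp (lam * (r - (a + s))) * ((E y).toReal - (E (η r)).toReal)) a
    rw [← h2] at h1
    simpa only [add_sub_add_left_eq_sub] using h1

/-- The integrated inequality with the energy frozen at the final time. -/
lemma step (hbot : ∀ x, E x ≠ ⊥) (h : IsIntegralEVIFlow E lam η) {s t : ℝ} (hs : 0 ≤ s)
    (hst : s < t) {y : X} (hy : E y < ⊤) :
    Real.exp (lam * (t - s)) / 2 * dist (η t) y ^ 2 - dist (η s) y ^ 2 / 2 ≤
      expIntegral lam (t - s) * ((E y).toReal - (E (η t)).toReal) := by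
  have hpos : ∀ s, 0 < s → s < t →
      Real.exp (lam * (t - s)) / 2 * dist (η t) y ^ 2 - dist (η s) y ^ 2 / 2 ≤
      expIntegral lam (t - s) * ((E y).toReal - (E (η t)).toReal) := by
    intro s hs hst
    refine (h.integral_evi y s t hs hst.le hy).trans ?_
    have h1 : expIntegral lam (t - s) * ((E y).toReal - (E (η t)).toReal) =
        ∫ r in s..t, Real.exp (lam * (r - s)) * ((E y).toReal - (E (η t)).toReal) := by
      rw [intervalIntegral.integral_mul_const, expIntegral,
        intervalIntegral.integral_comp_sub_right (fun r => Real.exp (lam * r)) s, sub_self]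
    rw [h1]
    refine intervalIntegral.integral_mono_on hst.le
      ((intervalIntegrable_const.sub (h.intervalIntegrable hbot hs hst.le)).continuousOn_mul
        (Continuous.continuousOn (by fun_prop)))
      (Continuous.intervalIntegrable (by fun_prop) _ _) fun r hr => ?_
    have := h.toReal_antitoneOn hbot (Set.mem_Ioi.2 (hs.trans_le hr.1))
      (Set.mem_Ioi.2 (hs.trans hst)) hr.2
    simp only at this
    gcongr
  rcases hs.eq_or_lt with rfl | hs
  -- The integrated inequality starts at positive times only; s = 0 is reached as a limit.
  · have hη : Tendsto η (𝓝[>] 0) (𝓝 (η 0)) :=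
      (h.continuousOn 0 Set.self_mem_Ici).mono_left (nhdsWithin_mono _ Set.Ioi_subset_Ici_self)
    have hid : Tendsto (fun s : ℝ => t - s) (𝓝[>] 0) (𝓝 (t - 0)) :=
      ((continuous_const.sub continuous_id).tendsto 0).mono_left nhdsWithin_le_nhds
    have hL : Tendsto (fun s => Real.exp (lam * (t - s)) / 2 * dist (η t) y ^ 2
        - dist (η s) y ^ 2 / 2) (𝓝[>] 0)
        (𝓝 (Real.exp (lam * (t - 0)) / 2 * dist (η t) y ^ 2 - dist (η 0) y ^ 2 / 2)) :=
      (((((Real.continuous_exp.tendsto _).comp (hid.const_mul lam)).div_const 2).mul_const _)).sub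
        (((hη.dist tendsto_const_nhds).pow 2).div_const 2)
    have hR : Tendsto (fun s => expIntegral lam (t - s) * ((E y).toReal - (E (η t)).toReal))
        (𝓝[>] 0) (𝓝 (expIntegral lam (t - 0) * ((E y).toReal - (E (η t)).toReal))) :=
      (((continuous_expIntegral lam).tendsto _).comp hid).mul_const _
    refine le_of_tendsto_of_tendsto hL hR ?_
    filter_upwards [Ioo_mem_nhdsGT hst] with s hs
    exact hpos s hs.1 hs.2
  · exact hpos s hs hst

lemma lt_top_of_le (h : IsIntegralEVIFlow E lam η) {s t : ℝ} (hs : 0 ≤ s)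
    (hst : s ≤ t) (hsE : E (η s) < ⊤) : E (η t) < ⊤ := by
  rcases hst.eq_or_lt with rfl | hst
  · exact hsE
  · exact h.lt_top t (hs.trans_lt hst)

/-- Unlike `antitoneOn`, this includes s = 0 when the initial energy is finite: `step` is tested at
y = η_s. -/
lemma toReal_le (hbot : ∀ x, E x ≠ ⊥) (h : IsIntegralEVIFlow E lam η) {s t : ℝ} (hs : 0 ≤ s)
    (hst : s ≤ t) (hsE : E (η s) < ⊤) : (E (η t)).toReal ≤ (E (η s)).toReal := by
  rcases hst.eq_or_lt with rfl | hst
  · rfl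
  have h1 := h.step hbot hs hst hsE
  rw [dist_self] at h1
  have h2 := Real.exp_pos (lam * (t - s))
  have h3 : 0 ≤ Real.exp (lam * (t - s)) / 2 * dist (η t) (η s) ^ 2 := by positivity
  have h4 := expIntegral_pos lam (sub_pos.2 hst)
  by_contra hcon
  push Not at hcon
  have : expIntegral lam (t - s) * ((E (η s)).toReal - (E (η t)).toReal) < 0 :=
    mul_neg_of_pos_of_neg h4 (by linarith)
  linarith

/-- The energy is right-continuous along the flow. -/
lemma tendsto_toReal (hbot : ∀ x, E x ≠ ⊥) (hlsc : LowerSemicontinuous E)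
    (h : IsIntegralEVIFlow E lam η) {s : ℝ} (hs : 0 ≤ s) (hsE : E (η s) < ⊤) :
    Tendsto (fun r => (E (η r)).toReal) (𝓝[>] s) (𝓝 (E (η s)).toReal) := by
  have hη : Tendsto η (𝓝[>] s) (𝓝 (η s)) :=
    (h.continuousOn s hs).mono_left (nhdsWithin_mono _ fun r hr => hs.trans (le_of_lt hr))
  rw [tendsto_order]
  refine ⟨fun c hc => ?_, fun c hc => ?_⟩
  · have h1 : (c : EReal) < E (η s) := by
      rwa [← EReal.coe_toReal hsE.ne (hbot _), EReal.coe_lt_coe_iff]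
    filter_upwards [hη.eventually (hlsc (η s) c h1), self_mem_nhdsWithin] with r hr hrs
    have h2 : E (η r) < ⊤ := h.lt_top_of_le hs (le_of_lt hrs) hsE
    change (c : EReal) < E (η r) at hr
    rwa [← EReal.coe_toReal h2.ne (hbot _), EReal.coe_lt_coe_iff] at hr
  · filter_upwards [self_mem_nhdsWithin] with r hrs
    exact lt_of_le_of_lt (h.toReal_le hbot hs (le_of_lt hrs) hsE) hc

/-- Moves one flow at a time: `step` for η tested at ξ_z, multiplied by e^{λ(z-x)}, plus `step` for
ξ tested at η_x. The mixed distance d(η_x, ξ_z) cancels, and the energy differences are grouped so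
that each tends to 0 or carries a vanishing factor as z ↓ x. -/
lemma two_step (hbot : ∀ x, E x ≠ ⊥) (hη : IsIntegralEVIFlow E lam η)
    (hξ : IsIntegralEVIFlow E lam ξ) {x z : ℝ} (hx : 0 < x) (hxz : x < z) :
    Real.exp (2 * lam * z) * (dist (η z) (ξ z) ^ 2 / 2)
        - Real.exp (2 * lam * x) * (dist (η x) (ξ x) ^ 2 / 2) ≤
      Real.exp (2 * lam * x) * (expIntegral lam (z - x) *
        ((Real.exp (lam * (z - x)) - 1) * ((E (ξ z)).toReal - (E (η z)).toReal)
          + ((E (η x)).toReal - (E (η z)).toReal))) := by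
  have h1 := hη.step hbot hx.le hxz (hξ.lt_top z (hx.trans hxz))
  have h2 := hξ.step hbot hx.le hxz (hη.lt_top x hx)
  rw [dist_comm (ξ z), dist_comm (ξ x)] at h2
  have h3 : Real.exp (2 * lam * z) = Real.exp (2 * lam * x) *
      (Real.exp (lam * (z - x)) * Real.exp (lam * (z - x))) := by
    rw [← Real.exp_add, ← Real.exp_add]; congr 1; ring
  rw [h3]
  have h4 := Real.exp_pos (lam * (z - x))
  have h5 := mul_le_mul_of_nonneg_left h1 h4.le
  rw [mul_assoc, ← mul_sub]
  refine mul_le_mul_of_nonneg_left ?_ (Real.exp_pos _).le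
  nlinarith

/-- Integral `EVI` flows contract distances, up to the factor `e^{-lam t}`. -/
lemma dist_le_of_pos (hbot : ∀ x, E x ≠ ⊥) (hlsc : LowerSemicontinuous E)
    (hη : IsIntegralEVIFlow E lam η) (hξ : IsIntegralEVIFlow E lam ξ) {s t : ℝ} (hs : 0 < s)
    (hst : s ≤ t) :
    Real.exp (lam * t) * dist (η t) (ξ t) ≤ Real.exp (lam * s) * dist (η s) (ξ s) := by
  set G : ℝ → ℝ := fun r => Real.exp (2 * lam * r) * (dist (η r) (ξ r) ^ 2 / 2) with hG
  have hsub : Set.Icc s t ⊆ Set.Ici 0 := fun r hr => hs.le.trans hr.1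
  have hGc : ContinuousOn G (Set.Icc s t) := by
    refine ContinuousOn.mul (Continuous.continuousOn (by fun_prop)) ?_
    exact ((continuous_dist.comp_continuousOn ((hη.continuousOn.mono hsub).prodMk
      (hξ.continuousOn.mono hsub))).pow 2).div_const 2
  have key : G t ≤ G s := by
    -- G need not be differentiable; nonpositive right upper slopes suffice. By right continuity of
    -- the energies, the bound in `two_step` is o(z - x).
    refine image_le_of_liminf_slope_right_le_deriv_boundary (B := fun _ => G s) (B' := fun _ => 0)
      hGc le_rfl continuousOn_const (fun x _ => hasDerivWithinAt_const _ _ _) ?_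
      (Set.right_mem_Icc.2 hst)
    intro x hx r hr
    have hx0 : 0 < x := hs.trans_le hx.1
    have hsubt : Tendsto (fun z : ℝ => z - x) (𝓝[>] x) (𝓝[>] 0) := by
      refine tendsto_nhdsWithin_iff.2 ⟨?_, ?_⟩
      · have : Tendsto (fun z : ℝ => z - x) (𝓝 x) (𝓝 (x - x)) :=
          (continuous_id.sub continuous_const).tendsto x
        rw [sub_self] at this
        exact this.mono_left nhdsWithin_le_nhds
      · filter_upwards [self_mem_nhdsWithin] with z hz
        exact sub_pos.2 (Set.mem_Ioi.1 hz)
    have e1 := hη.tendsto_toReal hbot hlsc hx0.le (hη.lt_top x hx0)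
    have e2 := hξ.tendsto_toReal hbot hlsc hx0.le (hξ.lt_top x hx0)
    have e3 : Tendsto (fun z : ℝ => Real.exp (lam * (z - x)) - 1) (𝓝[>] x) (𝓝 0) := by
      have : Tendsto (fun z : ℝ => Real.exp (lam * (z - x)) - 1) (𝓝 x)
          (𝓝 (Real.exp (lam * (x - x)) - 1)) := Continuous.tendsto (by fun_prop) x
      simp only [sub_self, mul_zero, Real.exp_zero] at this
      exact this.mono_left nhdsWithin_le_nhds
    have hQ : Tendsto (fun z => Real.exp (2 * lam * x) * (expIntegral lam (z - x) / (z - x) *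
        ((Real.exp (lam * (z - x)) - 1) * ((E (ξ z)).toReal - (E (η z)).toReal)
          + ((E (η x)).toReal - (E (η z)).toReal)))) (𝓝[>] x) (𝓝 0) := by
      have := (((tendsto_expIntegral_div lam).comp hsubt).mul ((e3.mul (e2.sub e1)).add
        ((tendsto_const_nhds (x := (E (η x)).toReal)).sub e1))).const_mul (Real.exp (2 * lam * x))
      simpa using this
    refine Eventually.frequently ?_
    filter_upwards [hQ.eventually (gt_mem_nhds hr), self_mem_nhdsWithin] with z hz hxz
    have hxz' : 0 < z - x := sub_pos.2 hxz
    refine lt_of_le_of_lt ?_ hz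
    rw [slope_def_field, div_le_iff₀ hxz']
    refine (hη.two_step hbot hξ hx0 hxz).trans (le_of_eq ?_)
    field_simp
  simp only [hG] at key
  have h1 : ∀ r, Real.exp (2 * lam * r) * (dist (η r) (ξ r) ^ 2 / 2) =
      (Real.exp (lam * r) * dist (η r) (ξ r)) ^ 2 / 2 := by
    intro r
    rw [mul_pow, ← Real.exp_nat_mul]
    push_cast
    rw [← mul_assoc]
    ring
  rw [h1, h1] at key
  refine le_of_sq_le_sq ?_ (by positivity)
  linarith

lemma dist_le (hbot : ∀ x, E x ≠ ⊥) (hlsc : LowerSemicontinuous E)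
    (hη : IsIntegralEVIFlow E lam η) (hξ : IsIntegralEVIFlow E lam ξ) {t : ℝ} (ht : 0 ≤ t) :
    Real.exp (lam * t) * dist (η t) (ξ t) ≤ dist (η 0) (ξ 0) := by
  rcases ht.eq_or_lt with rfl | ht
  · simp
  have h1 : ∀ {ζ : ℝ → X}, IsIntegralEVIFlow E lam ζ → Tendsto ζ (𝓝[>] 0) (𝓝 (ζ 0)) := fun hζ =>
    (hζ.continuousOn 0 Set.self_mem_Ici).mono_left (nhdsWithin_mono _ Set.Ioi_subset_Ici_self)
  have h2 : Tendsto (fun s : ℝ => Real.exp (lam * s)) (𝓝[>] 0) (𝓝 (Real.exp (lam * 0))) :=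
    (Continuous.tendsto (by fun_prop) 0).mono_left nhdsWithin_le_nhds
  have h3 := h2.mul ((h1 hη).dist (h1 hξ))
  rw [mul_zero, Real.exp_zero, one_mul] at h3
  refine ge_of_tendsto h3 ?_
  filter_upwards [Ioo_mem_nhdsGT ht] with s hs
  exact dist_le_of_pos hbot hlsc hη hξ hs.1 hs.2.le

end IsIntegralEVIFlow

/-! ### The semigroup as an integral flow, and its contraction estimate -/

section Semigroup

variable {X : Type*} [MetricSpace X] {E : X → EReal} {lam : ℝ}

lemma eviSemigroup_of_nonpos {t : ℝ} (ht : t ≤ 0) (x : X) : eviSemigroup E lam t x = x :=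
  dif_neg fun h => absurd h.1 (not_lt.2 ht)

@[simp] lemma eviSemigroup_zero (x : X) : eviSemigroup E lam 0 x = x :=
  eviSemigroup_of_nonpos le_rfl x

lemma EVISetting.isIntegralEVIFlow (hE : EVISetting E lam) (x : X) :
    IsIntegralEVIFlow E lam (fun t => eviSemigroup E lam t x) := by
  -- The choice in `eviSemigroup` depends on the existence statement and not on t, so a single η
  -- serves all positive times.
  obtain ⟨η, hη, heq⟩ : ∃ η : ℝ → X, IsEVIFlowFrom E lam x η ∧
      ∀ t, 0 < t → eviSemigroup E lam t x = η t :=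
    ⟨(hE.exists_flow x).choose, (hE.exists_flow x).choose_spec, fun t ht =>
      dif_pos (⟨ht, hE.exists_flow x⟩ : 0 < t ∧ ∃ η : ℝ → X, IsEVIFlowFrom E lam x η)⟩
  have hfl := hη.isEVIFlow
  refine ⟨?_, fun t ht => ?_, fun s hs t ht hst => ?_, fun y s t hs hst hy => ?_⟩
  · intro t ht
    rcases (Set.mem_Ici.1 ht).eq_or_lt with rfl | ht
    · rw [← continuousWithinAt_Ioi_iff_Ici, ContinuousWithinAt, eviSemigroup_zero]
      refine hη.tendsto.congr' ?_
      filter_upwards [self_mem_nhdsWithin] with s hs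
      rw [heq s hs]
    · have h1 := (hfl.locally_ac (t / 2) (t + 1) (by linarith) (by linarith)).continuousOn_Icc
        (by linarith)
      have h2 : ContinuousAt η t := h1.continuousAt (Icc_mem_nhds (by linarith) (by linarith))
      refine (h2.congr ?_).continuousWithinAt
      filter_upwards [lt_mem_nhds ht] with s hs
      rw [heq s hs]
  · rw [heq t ht]; exact hfl.lt_top hE ht
  · simp only [heq s hs, heq t ht]; exact hfl.antitoneOn hE hs ht hst
  · have h1 := (hfl.integral_evi hE hy hs hst).2
    rw [heq s hs, heq t (hs.trans_le hst)]
    refine h1.trans (le_of_eq (intervalIntegral.integral_congr fun r hr => ?_))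
    rw [Set.uIcc_of_le hst] at hr
    simp only [heq r (hs.trans_le hr.1)]

lemma EVISetting.dist_eviSemigroup_le (hE : EVISetting E lam) {t : ℝ} (ht : 0 ≤ t) (x y : X) :
    dist (eviSemigroup E lam t x) (eviSemigroup E lam t y) ≤ Real.exp (-(lam * t)) * dist x y := by
  have h := (hE.isIntegralEVIFlow x).dist_le hE.ne_bot hE.lsc (hE.isIntegralEVIFlow y) ht
  simp only [eviSemigroup_zero] at h
  rw [Real.exp_neg, ← div_eq_inv_mul, le_div_iff₀' (Real.exp_pos _)]
  exact h

end Semigroup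

/-! ### Slope and dissipation along the flow -/

/-- Some difference quotient of `E` at `z`, corrected by the convexity term, exceeds `p`. -/
def GlobalSlopeGT {X : Type*} [MetricSpace X] (E : X → EReal) (lam p : ℝ) (z : X) : Prop :=
  ∃ y, E y < ⊤ ∧ (E y).toReal + p * dist z y < (E z).toReal + lam / 2 * dist z y ^ 2

/-- Continuous induction. The supremum of the points where the bound from `a` holds satisfies it
again because `f` is antitone, with no continuity needed; if it were below `b`, `h` would push
further. -/
lemma le_sub_of_forall_exists_gt {f : ℝ → ℝ} {a b c : ℝ} (hab : a ≤ b) (hc : 0 < c)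
    (hf : AntitoneOn f (Set.Icc a b))
    (h : ∀ x ∈ Set.Ico a b, ∃ z ∈ Set.Ioc x b, c * (z - x) ≤ f x - f z) :
    c * (b - a) ≤ f a - f b := by
  set A : Set ℝ := {x ∈ Set.Icc a b | c * (x - a) ≤ f a - f x} with hA
  have haA : a ∈ A := ⟨Set.left_mem_Icc.2 hab, by simp⟩
  have hbdd : BddAbove A := ⟨b, fun x hx => hx.1.2⟩
  have hσ1 : a ≤ sSup A := le_csSup hbdd haA
  have hσ2 : sSup A ≤ b := csSup_le ⟨a, haA⟩ fun x hx => hx.1.2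
  have hσ : sSup A ∈ A := by
    refine ⟨⟨hσ1, hσ2⟩, ?_⟩
    have : sSup A ≤ a + (f a - f (sSup A)) / c := by
      refine csSup_le ⟨a, haA⟩ fun x hx => ?_
      have h1 := hf hx.1 ⟨hσ1, hσ2⟩ (le_csSup hbdd hx)
      have h2 := hx.2
      rw [← sub_le_iff_le_add', le_div_iff₀ hc]
      linarith
    rw [← sub_le_iff_le_add', le_div_iff₀ hc] at this
    linarith
  rcases hσ2.eq_or_lt with heq | hlt
  · have := hσ.2
    rwa [heq] at this
  · obtain ⟨z, hz, hzc⟩ := h _ ⟨hσ1, hlt⟩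
    have hzA : z ∈ A := ⟨⟨hσ1.trans hz.1.le, hz.2⟩, by
      have := hσ.2
      linarith⟩
    exact absurd (le_csSup hbdd hzA) (not_le.2 hz.1)

namespace IsIntegralEVIFlow

variable {X : Type*} [MetricSpace X] {E : X → EReal} {lam : ℝ} {η ξ : ℝ → X}

/-- The initial speed of the flow is at least the slope. -/
lemma eventually_lt_dist (hbot : ∀ x, E x ≠ ⊥) (hlsc : LowerSemicontinuous E)
    (h : IsIntegralEVIFlow E lam η) (h0 : E (η 0) < ⊤) {p : ℝ}
    (hslope : GlobalSlopeGT E lam p (η 0)) :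
    ∀ᶠ δ in 𝓝[>] (0 : ℝ), p * δ < dist (η 0) (η δ) := by
  obtain ⟨y, hy, hlt⟩ := hslope
  set d := dist (η 0) y with hd
  have hd0 : 0 ≤ d := dist_nonneg
  by_contra hcon
  have hfreq : ∃ᶠ δ in 𝓝[>] (0 : ℝ), dist (η 0) (η δ) ≤ p * δ := by
    simpa only [not_eventually, not_lt] using hcon
  -- If η moved by at most pδ, then d²(η_δ, y) ≥ d² - 2dpδ. Inserted in `step` and divided by δ → 0,
  -- this gives λ/2·d² - pd ≤ E(y) - E(η_0), against the choice of y.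
  have hφ : HasDerivAt (fun δ : ℝ => Real.exp (lam * δ) / 2 * (d ^ 2 - 2 * d * p * δ))
      (lam / 2 * d ^ 2 - p * d) 0 := by
    have h1 : HasDerivAt (fun δ : ℝ => Real.exp (lam * δ) / 2)
        (Real.exp (lam * 0) * (lam * 1) / 2) 0 :=
      (((hasDerivAt_id (0 : ℝ)).const_mul lam).exp).div_const 2
    have h2 : HasDerivAt (fun δ : ℝ => d ^ 2 - 2 * d * p * δ) (-(2 * d * p * 1)) 0 :=
      ((hasDerivAt_id (0 : ℝ)).const_mul (2 * d * p)).const_sub _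
    have h3 := h1.fun_mul h2
    simp only [mul_zero, Real.exp_zero, mul_one, sub_zero, one_mul] at h3
    exact h3.congr_deriv (by ring)
  have hL : Tendsto (fun δ : ℝ => (Real.exp (lam * δ) / 2 * (d ^ 2 - 2 * d * p * δ)
      - d ^ 2 / 2) / δ) (𝓝[>] 0) (𝓝 (lam / 2 * d ^ 2 - p * d)) := by
    have h1 := (hasDerivAt_iff_tendsto_slope.1 hφ).mono_left (nhdsWithin_mono (0 : ℝ)
      fun x (hx : x ∈ Set.Ioi (0 : ℝ)) => (Set.mem_compl_singleton_iff.2 (ne_of_gt hx)))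
    refine h1.congr fun δ => ?_
    rw [slope_def_field]
    simp only [mul_zero, Real.exp_zero, sub_zero]
    ring
  have hR : Tendsto (fun δ : ℝ => expIntegral lam δ / δ * ((E y).toReal - (E (η δ)).toReal))
      (𝓝[>] 0) (𝓝 (1 * ((E y).toReal - (E (η 0)).toReal))) :=
    (tendsto_expIntegral_div lam).mul
      (tendsto_const_nhds.sub (h.tendsto_toReal hbot hlsc le_rfl h0))
  have hdiff := hR.sub hL
  have hge : 0 ≤ 1 * ((E y).toReal - (E (η 0)).toReal) - (lam / 2 * d ^ 2 - p * d) := by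
    refine ge_of_tendsto_of_frequently hdiff ?_
    refine (hfreq.and_eventually self_mem_nhdsWithin).mono fun δ hδ => ?_
    obtain ⟨hδ, hδ0 : 0 < δ⟩ := hδ
    have h1 := h.step hbot le_rfl hδ0 hy
    rw [sub_zero] at h1
    have h2 : d ≤ dist (η δ) y + dist (η 0) (η δ) := by
      rw [hd, add_comm]; exact dist_triangle _ _ _
    have h3 : d ^ 2 - 2 * d * p * δ ≤ dist (η δ) y ^ 2 := by
      have h4 : d * dist (η 0) (η δ) ≤ d * (p * δ) := mul_le_mul_of_nonneg_left hδ hd0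
      nlinarith [sq_nonneg (dist (η δ) y - d)]
    have h5 : Real.exp (lam * δ) / 2 * (d ^ 2 - 2 * d * p * δ) - d ^ 2 / 2 ≤
        expIntegral lam δ * ((E y).toReal - (E (η δ)).toReal) := by
      refine le_trans ?_ h1
      have := Real.exp_pos (lam * δ)
      gcongr
    rw [sub_nonneg, div_le_iff₀ hδ0]
    refine h5.trans (le_of_eq ?_)
    field_simp
  linarith

/-- The energy dissipated by the flow is bounded below by the squared slope at the final time. -/
lemma le_dissipation (hbot : ∀ x, E x ≠ ⊥) (hlsc : LowerSemicontinuous E)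
    (h : IsIntegralEVIFlow E lam η) {a b : ℝ} (ha : 0 < a) (hab : a ≤ b) {p : ℝ} (hp : 0 ≤ p)
    (hslope : p = 0 ∨ GlobalSlopeGT E lam p (η b)) :
    Real.exp (-(2 * |lam| * (b - a))) * p ^ 2 * (b - a) ≤ (E (η a)).toReal - (E (η b)).toReal := by
  have hanti := h.toReal_antitoneOn hbot
  have hb : 0 < b := ha.trans_le hab
  rcases hslope with rfl | hslope
  · have : (E (η b)).toReal ≤ (E (η a)).toReal := hanti ha hb hab
    simpa using this
  set q := Real.exp (-(|lam| * (b - a))) * p with hq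
  have hq0 : 0 ≤ q := by positivity
  have hq2 : Real.exp (-(2 * |lam| * (b - a))) * p ^ 2 = q ^ 2 := by
    rw [hq, mul_pow, ← Real.exp_nat_mul]
    congr 2; push_cast; ring
  rw [hq2]
  -- The displacement at time b is at least pδ, and contraction from s to b bounds it by the
  -- displacement at s. The threshold on δ is set at b, hence is uniform in s.
  have hspeed : ∀ᶠ δ in 𝓝[>] (0 : ℝ), ∀ s ∈ Set.Ico a b, q * δ ≤ dist (η (s + δ)) (η s) := by
    have h1 := (h.shift hb.le).eventually_lt_dist hbot hlsc (by simpa using h.lt_top b hb)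
      (by simpa using hslope)
    filter_upwards [h1, self_mem_nhdsWithin] with δ hδ hδ0 s hs
    have hδ0' : 0 < δ := hδ0
    have hs0 : 0 ≤ s := ha.le.trans hs.1
    have h2 := (h.shift hs0).dist_le hbot hlsc (h.shift (a := s + δ) (by linarith)) (t := b - s)
      (by linarith [hs.2])
    simp only [add_zero, add_sub_cancel] at h2 hδ
    rw [show s + δ + (b - s) = b + δ by ring] at h2
    rw [dist_comm (η (s + δ))]
    refine le_trans ?_ h2
    have h3 : -(|lam| * (b - a)) ≤ lam * (b - s) :=
      (neg_abs_mul_le_mul lam (by linarith [hs.2]) (by linarith [hs.1])).1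
    have h4 := Real.exp_le_exp.2 h3
    calc q * δ = Real.exp (-(|lam| * (b - a))) * (p * δ) := by rw [hq]; ring
      _ ≤ Real.exp (lam * (b - s)) * dist (η b) (η (b + δ)) := by gcongr
  by_contra hcon
  push Not at hcon
  have hab' : a < b := by
    rcases hab.eq_or_lt with rfl | hab'
    · simp at hcon
    · exact hab'
  have hba : 0 < b - a := sub_pos.2 hab'
  have hEab : 0 ≤ (E (η a)).toReal - (E (η b)).toReal := sub_nonneg.2 (hanti ha hb hab)
  rw [← div_lt_iff₀ hba] at hcon
  obtain ⟨c, hc1, hc2⟩ := exists_between hcon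
  have hc0 : 0 < c := lt_of_le_of_lt (by positivity) hc1
  -- If the energy fell more slowly than c after some s, the inequality tested at η_s would give
  -- d²(η_{s+δ}, η_s) ≤ (c + o(1))δ². The lower bound (qδ)² then contradicts c < q².
  have hmain : c * (b - a) ≤ (E (η a)).toReal - (E (η b)).toReal := by
    refine le_sub_of_forall_exists_gt (f := fun t => (E (η t)).toReal) hab hc0
      (hanti.mono fun r hr => ha.trans_le hr.1) fun s hs => ?_
    by_contra hnot
    push Not at hnot
    have hs0 : 0 < s := ha.trans_le hs.1
    have hlim : Tendsto (fun δ : ℝ => Real.exp (|lam| * δ) * c - Real.exp (lam * δ) * q ^ 2)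
        (𝓝[>] 0) (𝓝 (c - q ^ 2)) := by
      have : Tendsto (fun δ : ℝ => Real.exp (|lam| * δ) * c - Real.exp (lam * δ) * q ^ 2)
        (𝓝 0) (𝓝 (Real.exp (|lam| * 0) * c - Real.exp (lam * 0) * q ^ 2)) :=
        Continuous.tendsto (by fun_prop) 0
      simp only [mul_zero, Real.exp_zero, one_mul] at this
      exact this.mono_left nhdsWithin_le_nhds
    have hge : 0 ≤ c - q ^ 2 := by
      refine ge_of_tendsto hlim ?_
      filter_upwards [hspeed, Ioo_mem_nhdsGT (sub_pos.2 hs.2)] with δ hδ hδb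
      have hδ0 : 0 < δ := hδb.1
      have h1 := h.integral_evi (η s) s (s + δ) hs0 (by linarith) (h.lt_top s hs0)
      rw [dist_self, add_sub_cancel_left] at h1
      have h2 : ∫ r in s..(s + δ), Real.exp (lam * (r - s)) *
          ((E (η s)).toReal - (E (η r)).toReal) ≤
          ∫ r in s..(s + δ), Real.exp (|lam| * δ) * c * (r - s) := by
        refine intervalIntegral.integral_mono_on (by linarith)
          ((intervalIntegrable_const.sub
            (h.intervalIntegrable hbot hs0 (by linarith))).continuousOn_mul
            (Continuous.continuousOn (by fun_prop)))
          (Continuous.intervalIntegrable (by fun_prop) _ _) fun r hr => ?_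
        have h3 : (E (η s)).toReal - (E (η r)).toReal ≤ c * (r - s) := by
          rcases hr.1.eq_or_lt with rfl | hsr
          · simp
          · exact (hnot r ⟨hsr, by linarith [hr.2, hδb.2]⟩).le
        have h4 : 0 ≤ (E (η s)).toReal - (E (η r)).toReal :=
          sub_nonneg.2 (hanti hs0 (Set.mem_Ioi.2 (hs0.trans_le hr.1)) hr.1)
        have h5 := (neg_abs_mul_le_mul lam (r := r - s) (h := δ) (by linarith [hr.1])
          (by linarith [hr.2])).2
        rw [mul_assoc]
        gcongr
      have h6 : ∫ r in s..(s + δ), Real.exp (|lam| * δ) * c * (r - s) =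
          Real.exp (|lam| * δ) * c * (δ ^ 2 / 2) := by
        rw [intervalIntegral.integral_const_mul,
          intervalIntegral.integral_comp_sub_right (fun r => r) s]
        simp
      have h7 : (q * δ) ^ 2 ≤ dist (η (s + δ)) (η s) ^ 2 := by
        have := hδ s hs
        gcongr
      have h8 : Real.exp (lam * δ) / 2 * (q * δ) ^ 2 ≤ Real.exp (|lam| * δ) * c * (δ ^ 2 / 2) := by
        have := mul_le_mul_of_nonneg_left h7 (a := Real.exp (lam * δ) / 2) (by positivity)
        linarith
      have h9 : 0 ≤ (Real.exp (|lam| * δ) * c - Real.exp (lam * δ) * q ^ 2) * (δ ^ 2 / 2) := by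
        nlinarith
      exact nonneg_of_mul_nonneg_left h9 (by positivity)
    linarith
  rw [div_lt_iff₀ hba] at hc1
  linarith

/-- The integrated inequality with the dissipation term. -/
lemma step_add_slope (hbot : ∀ x, E x ≠ ⊥) (hlsc : LowerSemicontinuous E)
    (h : IsIntegralEVIFlow E lam η) {a b : ℝ} (ha : 0 < a) (hab : a < b) {p : ℝ} (hp : 0 ≤ p)
    (hslope : p = 0 ∨ GlobalSlopeGT E lam p (η b)) {y : X} (hy : E y < ⊤) :
    Real.exp (lam * (b - a)) / 2 * dist (η b) y ^ 2
      + expIntegral lam (b - a) * ((E (η b)).toReal - (E y).toReal)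
      + Real.exp (-(3 * |lam| * (b - a))) * p ^ 2 * ((b - a) ^ 2 / 2) ≤ dist (η a) y ^ 2 / 2 := by
  have h1 := h.integral_evi y a b ha hab.le hy
  set K := Real.exp (-(3 * |lam| * (b - a))) * p ^ 2 with hK
  -- The dissipation bound on [r,b] contributes p²(b - r), whose integral is p²(b - a)²/2. In the
  -- exponent 3|λ|, two parts come from `le_dissipation` and one from the weight e^{λ(r-a)}.
  have h2 : ∫ r in a..b, Real.exp (lam * (r - a)) * ((E y).toReal - (E (η r)).toReal) ≤
      ∫ r in a..b, (Real.exp (lam * (r - a)) * ((E y).toReal - (E (η b)).toReal)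
        - K * (b - r)) := by
    refine intervalIntegral.integral_mono_on hab.le
      ((intervalIntegrable_const.sub
        (h.intervalIntegrable hbot ha hab.le)).continuousOn_mul
        (Continuous.continuousOn (by fun_prop)))
      (Continuous.intervalIntegrable (by fun_prop) _ _) fun r hr => ?_
    have h3 := h.le_dissipation hbot hlsc (ha.trans_le hr.1) hr.2 hp hslope
    have h4 := (neg_abs_mul_le_mul lam (r := r - a) (h := b - a) (by linarith [hr.1])
      (by linarith [hr.2])).1
    have hbr : 0 ≤ b - r := by linarith [hr.2]
    have h5 : K * (b - r) ≤ Real.exp (lam * (r - a)) *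
        ((E (η r)).toReal - (E (η b)).toReal) := by
      have h6 : Real.exp (-(3 * |lam| * (b - a))) ≤
          Real.exp (lam * (r - a)) * Real.exp (-(2 * |lam| * (b - r))) := by
        rw [← Real.exp_add]
        refine Real.exp_le_exp.2 ?_
        have := mul_nonneg (abs_nonneg lam) (sub_nonneg.2 hr.1)
        nlinarith
      calc K * (b - r) ≤ Real.exp (lam * (r - a)) * Real.exp (-(2 * |lam| * (b - r)))
              * p ^ 2 * (b - r) := by rw [hK]; gcongr
        _ = Real.exp (lam * (r - a)) * (Real.exp (-(2 * |lam| * (b - r))) * p ^ 2 * (b - r)) := by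
            ring
        _ ≤ _ := by gcongr
    linarith
  have h3 : ∫ r in a..b, (Real.exp (lam * (r - a)) * ((E y).toReal - (E (η b)).toReal)
      - K * (b - r)) = expIntegral lam (b - a) * ((E y).toReal - (E (η b)).toReal)
        - K * ((b - a) ^ 2 / 2) := by
    rw [intervalIntegral.integral_sub (Continuous.intervalIntegrable (by fun_prop) _ _)
      (Continuous.intervalIntegrable (by fun_prop) _ _), intervalIntegral.integral_mul_const,
      intervalIntegral.integral_const_mul,
      intervalIntegral.integral_comp_sub_right (fun r => Real.exp (lam * r)) a,
      intervalIntegral.integral_comp_sub_left (fun r => r) b]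
    simp [expIntegral]
  linarith

end IsIntegralEVIFlow

/-- The slope of `E` is approximated from below by global difference quotients. -/
lemma globalSlopeGT_of_lt_metricSlope {X : Type*} [MetricSpace X] {E : X → EReal} {lam : ℝ}
    (hbot : ∀ x, E x ≠ ⊥) {x : X} (hx : E x < ⊤) {p : ℝ} (hp : 0 ≤ p)
    (h : ENNReal.ofReal p < metricSlope E x) : GlobalSlopeGT E lam p x := by
  rw [metricSlope, if_pos (show x ∈ energyDomain E from hx)] at h
  obtain ⟨q', hpq, hq⟩ := exists_between h
  have hqt : q' ≠ ⊤ := hq.ne_top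
  lift q' to NNReal using hqt
  have hpq' : p < q' := by
    rw [← ENNReal.ofReal_coe_nnreal] at hpq
    exact (ENNReal.ofReal_lt_ofReal_iff_of_nonneg hp).1 hpq
  have hfreq := frequently_lt_of_lt_limsup (by isBoundedDefault) hq
  -- Near x the quadratic correction is absorbed by the gap between p and q'.
  have hball : ∀ᶠ y in 𝓝[≠] x, |lam| / 2 * dist x y < q' - p := by
    have : Tendsto (fun y => |lam| / 2 * dist x y) (𝓝 x) (𝓝 (|lam| / 2 * dist x x)) :=
      Continuous.tendsto (by fun_prop) x
    rw [dist_self, mul_zero] at this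
    exact (this.mono_left nhdsWithin_le_nhds).eventually (gt_mem_nhds (sub_pos.2 hpq'))
  obtain ⟨y, ⟨hy, hyb⟩, hyx⟩ := ((hfreq.and_eventually hball).and_eventually
    self_mem_nhdsWithin).exists
  have hxy : 0 < dist x y := dist_pos.2 fun h => hyx h.symm
  have hed : edist x y ≠ 0 := by rw [edist_dist]; simpa using hxy
  rw [ENNReal.lt_div_iff_mul_lt (Or.inl hed) (Or.inl (edist_ne_top x y))] at hy
  have hyE : E y < ⊤ := by
    by_contra hcon
    rw [not_lt_top_iff.1 hcon, EReal.sub_top, EReal.toENNReal_bot] at hy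
    exact absurd hy not_lt_zero
  refine ⟨y, hyE, ?_⟩
  rw [← EReal.coe_toReal hx.ne (hbot _), ← EReal.coe_toReal hyE.ne (hbot _), ← EReal.coe_sub,
    EReal.toENNReal_of_ne_top (EReal.coe_ne_top _), EReal.toReal_coe, edist_dist,
    ← ENNReal.ofReal_coe_nnreal, ← ENNReal.ofReal_mul q'.coe_nonneg] at hy
  have h1 := (ENNReal.ofReal_lt_ofReal_iff_of_nonneg (by positivity)).1 hy
  have h2 := neg_abs_le lam
  have h3 : |lam| / 2 * dist x y * dist x y ≤ (q' - p) * dist x y :=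
    mul_le_mul_of_nonneg_right hyb.le hxy.le
  have h4 : -(|lam| / 2 * dist x y * dist x y) ≤ lam / 2 * dist x y ^ 2 := by
    nlinarith [sq_nonneg (dist x y)]
  nlinarith

/-! ### Real-variable lemmas -/

section Curves

variable {X : Type*} [MetricSpace X] {γ : ℝ → X}

lemma setIntegral_toReal_Ioo {f : ℝ → ℝ≥0∞} {a b : ℝ} (hab : a ≤ b)
    (hf : AEMeasurable f (volume.restrict (Set.Ioo a b)))
    (hfin : ∫⁻ r in Set.Ioo a b, f r ≠ ⊤) :
    ∫ r in a..b, (f r).toReal = (∫⁻ r in Set.Ioo a b, f r).toReal := by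
  rw [intervalIntegral.integral_of_le hab, ← setIntegral_congr_set Ioo_ae_eq_Ioc,
    integral_toReal hf (ae_lt_top' hf hfin)]

lemma intervalIntegrable_toReal_Ioo {f : ℝ → ℝ≥0∞} {a b : ℝ} (hab : a ≤ b)
    (hf : AEMeasurable f (volume.restrict (Set.Ioo a b)))
    (hfin : ∫⁻ r in Set.Ioo a b, f r ≠ ⊤) :
    IntervalIntegrable (fun r => (f r).toReal) volume a b := by
  rw [intervalIntegrable_iff_integrableOn_Ioo_of_le hab]
  exact integrable_toReal_of_lintegral_ne_top hf hfin

lemma dist_le_integral_metricSpeed {s t : ℝ} (hst : s ≤ t)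
    (hγ : AbsolutelyContinuousOnInterval γ s t)
    (hfin : ∫⁻ r in Set.Ioo s t, metricSpeed γ r ≠ ⊤) :
    dist (γ s) (γ t) ≤ ∫ r in s..t, (metricSpeed γ r).toReal := by
  rw [setIntegral_toReal_Ioo hst (aemeasurable_metricSpeed hst (hγ.continuousOn_Icc hst)) hfin,
    dist_edist]
  exact ENNReal.toReal_mono hfin (edist_le_lintegral_metricSpeed hst hγ)

lemma dist_sq_le_integral_metricSpeed_sq {s t : ℝ} (hst : s ≤ t)
    (hγ : AbsolutelyContinuousOnInterval γ s t)
    (hfin : ∫⁻ r in Set.Ioo s t, metricSpeed γ r ^ 2 ≠ ⊤) :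
    dist (γ s) (γ t) ^ 2 ≤ (t - s) * ∫ r in s..t, (metricSpeed γ r ^ 2).toReal := by
  rw [setIntegral_toReal_Ioo hst
    ((aemeasurable_metricSpeed hst (hγ.continuousOn_Icc hst)).pow_const 2) hfin, dist_edist]
  have h := ENNReal.toReal_mono (ENNReal.mul_ne_top ENNReal.ofReal_ne_top hfin)
    (edist_sq_le_lintegral_metricSpeed_sq hst hγ)
  rwa [ENNReal.toReal_pow, ENNReal.toReal_mul, ENNReal.toReal_ofReal (sub_nonneg.2 hst)] at h

lemma lintegral_metricSpeed_ne_top {a b : ℝ}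
    (hfin : ∫⁻ r in Set.Ioo a b, metricSpeed γ r ^ 2 ≠ ⊤) :
    ∫⁻ r in Set.Ioo a b, metricSpeed γ r ≠ ⊤ := by
  have h : ∫⁻ r in Set.Ioo a b, metricSpeed γ r ≤
      ∫⁻ r in Set.Ioo a b, (1 + metricSpeed γ r ^ 2) := by
    refine lintegral_mono fun r => ?_
    rcases le_total (metricSpeed γ r) 1 with h | h
    · exact h.trans le_self_add
    · exact (le_self_pow₀ h (by norm_num)).trans le_add_self
  refine ne_top_of_le_ne_top ?_ h
  rw [lintegral_add_left measurable_const]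
  simp [hfin]

end Curves

lemma tendsto_primitive_nhdsGT {f : ℝ → ℝ} {T : ℝ} (hT : 0 < T) (hf : IntervalIntegrable f volume 0 T) :
    Tendsto (fun t => ∫ r in (0 : ℝ)..t, f r) (𝓝[>] 0) (𝓝 0) := by
  have h := intervalIntegral.continuousOn_primitive_interval' hf Set.left_mem_uIcc 0
    Set.left_mem_uIcc
  rw [ContinuousWithinAt, intervalIntegral.integral_same] at h
  refine h.mono_left (nhdsWithin_le_of_mem ?_)
  rw [Set.uIcc_of_le hT.le]
  exact mem_of_superset (Ioo_mem_nhdsGT hT) Set.Ioo_subset_Icc_self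

/-- Monotonicity makes `deriv g` integrable up to 0, so the fundamental theorem on [s,T] passes to
the limit s ↓ 0. -/
lemma absolutelyContinuousOnInterval_of_monotoneOn {g : ℝ → ℝ} {T : ℝ} (hT : 0 ≤ T)
    (hg : MonotoneOn g (Set.Icc 0 T))
    (hac : ∀ δ, 0 < δ → δ ≤ T → AbsolutelyContinuousOnInterval g δ T)
    (hg0 : Tendsto g (𝓝[>] 0) (𝓝 (g 0))) : AbsolutelyContinuousOnInterval g 0 T := by
  have hint : IntervalIntegrable (deriv g) volume 0 T :=
    MonotoneOn.intervalIntegrable_deriv (by rwa [Set.uIcc_of_le hT])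
  have hsub : ∀ s t, 0 ≤ s → s ≤ t → t ≤ T → IntervalIntegrable (deriv g) volume s t :=
    fun s t hs hst ht => hint.mono_set (by
      rw [Set.uIcc_of_le hst, Set.uIcc_of_le hT]; exact Set.Icc_subset_Icc hs ht)
  have hpos : ∀ s t, 0 < s → s ≤ t → t ≤ T → ∫ r in s..t, deriv g r = g t - g s := by
    intro s t hs hst ht
    refine AbsolutelyContinuousOnInterval.integral_deriv_eq_sub
      ((hac s hs (hst.trans ht)).mono ?_)
    rw [Set.uIcc_of_le hst, Set.uIcc_of_le (hst.trans ht)]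
    exact Set.Icc_subset_Icc_right ht
  have hall : ∀ t, 0 ≤ t → t ≤ T → ∫ r in (0 : ℝ)..t, deriv g r = g t - g 0 := by
    intro t ht htT
    rcases ht.eq_or_lt with rfl | ht
    · simp
    have h1 := tendsto_primitive_nhdsGT (ht.trans_le htT) hint
    have h4 : Tendsto (fun s => (∫ r in (0 : ℝ)..s, deriv g r) + (g t - g s)) (𝓝[>] 0)
        (𝓝 (0 + (g t - g 0))) := h1.add (tendsto_const_nhds.sub hg0)
    rw [zero_add] at h4
    refine tendsto_nhds_unique (Tendsto.congr' ?_ tendsto_const_nhds) h4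
    filter_upwards [Ioo_mem_nhdsGT ht] with s hs
    rw [← hpos s t hs.1 hs.2.le htT, intervalIntegral.integral_add_adjacent_intervals
      (hsub 0 s le_rfl hs.1.le (hs.2.le.trans htT)) (hsub s t hs.1.le hs.2.le htT)]
  refine absolutelyContinuousOnInterval_of_dist_le
    (hint.absolutelyContinuousOnInterval_intervalIntegral (c := 0) Set.left_mem_uIcc) 1 0
    fun s hs t ht => ?_
  rw [Set.uIcc_of_le hT] at hs ht
  rw [hall s hs.1 hs.2, hall t ht.1 ht.2]
  simp

lemma le_add_of_sq_le {x A B : ℝ} (hA : 0 ≤ A) (hB : 0 ≤ B)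
    (h : x ^ 2 ≤ A ^ 2 + B * x) : x ≤ A + B := by
  by_contra hcon
  push Not at hcon
  nlinarith

lemma ENNReal.le_ofReal_of_forall_lt {a : ℝ≥0∞} {c : ℝ}
    (h : ∀ q : ℝ, 0 ≤ q → ENNReal.ofReal q < a → q ≤ c) : a ≤ ENNReal.ofReal c := by
  by_contra hcon
  obtain ⟨q, hq1, hq2⟩ := exists_between (not_le.1 hcon)
  lift q to NNReal using hq2.ne_top
  rw [← ENNReal.ofReal_coe_nnreal] at hq1 hq2
  exact absurd (ENNReal.ofReal_le_ofReal (h q q.coe_nonneg hq2)) (not_le.2 hq1)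

/-- Strict approximants q < a and p < b are what upper limits supply; the value 0 is admitted
separately because a or b may vanish. Setting one of them to 0 shows that the other bound is finite;
then q = θa, p = θb with θ ↑ 1. -/
lemma ENNReal.sq_add_mul_sq_le_ofReal {a b : ℝ≥0∞} {ε R : ℝ} (hε : 0 < ε)
    (h : ∀ q p : ℝ, 0 ≤ q → 0 ≤ p → (q = 0 ∨ ENNReal.ofReal q < a) →
      (p = 0 ∨ ENNReal.ofReal p < b) → q ^ 2 + ε ^ 2 * p ^ 2 ≤ R) :
    a ^ 2 + ENNReal.ofReal (ε ^ 2) * b ^ 2 ≤ ENNReal.ofReal R := by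
  have ha : a ≤ ENNReal.ofReal (√R) := by
    refine ENNReal.le_ofReal_of_forall_lt fun q hq hqa => ?_
    refine (le_abs_self q).trans (Real.abs_le_sqrt ?_)
    simpa using h q 0 hq le_rfl (Or.inr hqa) (Or.inl rfl)
  have hb : b ≤ ENNReal.ofReal (√R / ε) := by
    refine ENNReal.le_ofReal_of_forall_lt fun p hp hpb => ?_
    rw [le_div_iff₀ hε]
    refine (le_abs_self (p * ε)).trans (Real.abs_le_sqrt ?_)
    have := h 0 p le_rfl hp (Or.inl rfl) (Or.inr hpb)
    nlinarith
  lift a to NNReal using ne_top_of_le_ne_top ENNReal.ofReal_ne_top ha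
  lift b to NNReal using ne_top_of_le_ne_top ENNReal.ofReal_ne_top hb
  have hθ : ∀ θ : ℝ, 0 ≤ θ → θ < 1 → ∀ c : NNReal, θ * c = 0 ∨ ENNReal.ofReal (θ * c) < c := by
    intro θ hθ0 hθ1 c
    rcases eq_or_ne c 0 with rfl | hc
    · simp
    · right
      have hc' : (0 : ℝ) < c := by positivity
      rw [← ENNReal.ofReal_coe_nnreal, ENNReal.ofReal_lt_ofReal_iff hc']
      nlinarith
  have hmain : (a : ℝ) ^ 2 + ε ^ 2 * (b : ℝ) ^ 2 ≤ R := by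
    have hlim : Tendsto (fun θ : ℝ => (θ * a) ^ 2 + ε ^ 2 * (θ * b) ^ 2) (𝓝[<] 1)
        (𝓝 ((1 * (a : ℝ)) ^ 2 + ε ^ 2 * (1 * (b : ℝ)) ^ 2)) :=
      (Continuous.tendsto (by fun_prop) 1).mono_left nhdsWithin_le_nhds
    rw [one_mul, one_mul] at hlim
    refine le_of_tendsto hlim ?_
    filter_upwards [Ioo_mem_nhdsLT (zero_lt_one' ℝ)] with θ hθ'
    exact h _ _ (mul_nonneg hθ'.1.le a.coe_nonneg) (mul_nonneg hθ'.1.le b.coe_nonneg) (hθ θ hθ'.1.le hθ'.2 a)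
      (hθ θ hθ'.1.le hθ'.2 b)
  rw [← ENNReal.ofReal_coe_nnreal, ← ENNReal.ofReal_coe_nnreal, ← ENNReal.ofReal_pow a.coe_nonneg,
    ← ENNReal.ofReal_pow b.coe_nonneg, ← ENNReal.ofReal_mul (by positivity),
    ← ENNReal.ofReal_add (by positivity) (by positivity)]
  exact ENNReal.ofReal_le_ofReal hmain

/-! ### Flowing a curve for a time growing linearly -/

/-- The curve `t ↦ S_{ε t} γ_t`. -/
noncomputable def flowedCurve {X : Type*} [MetricSpace X] (E : X → EReal) (lam ε : ℝ)
    (γ : ℝ → X) (t : ℝ) : X := eviSemigroup E lam (ε * t) (γ t)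

section FlowedCurve

variable {X : Type*} [MetricSpace X] {E : X → EReal} {lam ε T : ℝ} {γ : ℝ → X}

lemma flowedCurve_lt_top (hE : EVISetting E lam) (hε : 0 < ε) (h0 : E (γ 0) < ⊤) {t : ℝ}
    (ht : 0 ≤ t) : E (flowedCurve E lam ε γ t) < ⊤ := by
  rcases ht.eq_or_lt with rfl | ht
  · simpa [flowedCurve] using h0
  · exact (hE.isIntegralEVIFlow (γ t)).lt_top _ (mul_pos hε ht)

/-- The intermediate point S_{εs}γ_t is close to S_{εs}γ_s by contraction and to S_{εt}γ_t by
continuity of one flow. -/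
lemma continuousOn_flowedCurve (hE : EVISetting E lam) (hε : 0 < ε)
    (hγ : ContinuousOn γ (Set.Icc 0 T)) :
    ContinuousOn (flowedCurve E lam ε γ) (Set.Icc 0 T) := by
  intro t ht
  rw [ContinuousWithinAt, tendsto_iff_dist_tendsto_zero]
  have h1 : Tendsto (fun s => Real.exp (-(lam * (ε * s))) * dist (γ s) (γ t)) (𝓝[Set.Icc 0 T] t)
      (𝓝 0) := by
    have h2 : Tendsto (fun s => Real.exp (-(lam * (ε * s)))) (𝓝[Set.Icc 0 T] t)
      (𝓝 (Real.exp (-(lam * (ε * t))))) :=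
      (Continuous.tendsto (by fun_prop) t).mono_left nhdsWithin_le_nhds
    simpa using h2.mul (tendsto_iff_dist_tendsto_zero.1 (hγ t ht))
  have h3 : Tendsto (fun s => dist (eviSemigroup E lam (ε * s) (γ t))
      (eviSemigroup E lam (ε * t) (γ t))) (𝓝[Set.Icc 0 T] t) (𝓝 0) := by
    refine tendsto_iff_dist_tendsto_zero.1 ?_
    refine ((hE.isIntegralEVIFlow (γ t)).continuousOn (ε * t)
      (Set.mem_Ici.2 (mul_nonneg hε.le ht.1))).tendsto.comp ?_
    refine tendsto_nhdsWithin_iff.2 ⟨(Continuous.tendsto (by fun_prop) t).mono_left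
      nhdsWithin_le_nhds, ?_⟩
    filter_upwards [self_mem_nhdsWithin] with s hs
    exact Set.mem_Ici.2 (mul_nonneg hε.le hs.1)
  have h4 := h1.add h3
  rw [add_zero] at h4
  refine squeeze_zero' (Eventually.of_forall fun _ => dist_nonneg) ?_ h4
  filter_upwards [self_mem_nhdsWithin] with s hs
  refine (dist_triangle _ (eviSemigroup E lam (ε * s) (γ t)) _).trans (add_le_add ?_ le_rfl)
  exact hE.dist_eviSemigroup_le (mul_nonneg hε.le hs.1) _ _

/-- The basic two-point estimate for the flowed curve. -/
lemma flowedCurve_two_point (hE : EVISetting E lam) (hε : 0 < ε) (h0 : E (γ 0) < ⊤) {s t p : ℝ}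
    (hs : 0 ≤ s) (hst : s < t) (htT : t ≤ T) (hp : 0 ≤ p)
    (hslope : p = 0 ∨ (0 < s ∧ GlobalSlopeGT E lam p (flowedCurve E lam ε γ t))) :
    Real.exp (lam * (ε * (t - s))) / 2 *
        dist (flowedCurve E lam ε γ s) (flowedCurve E lam ε γ t) ^ 2
      + expIntegral lam (ε * (t - s)) * ((E (flowedCurve E lam ε γ t)).toReal
        - (E (flowedCurve E lam ε γ s)).toReal)
      + Real.exp (-(3 * |lam| * (ε * (t - s)))) * p ^ 2 * ((ε * (t - s)) ^ 2 / 2) ≤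
    Real.exp (2 * max (-lam) 0 * (ε * T)) / 2 * dist (γ s) (γ t) ^ 2 := by
  have hflow := hE.isIntegralEVIFlow (γ t)
  have hyE : E (flowedCurve E lam ε γ s) < ⊤ := flowedCurve_lt_top hE hε h0 hs
  have hab : ε * s < ε * t := mul_lt_mul_of_pos_left hst hε
  have hεs : 0 ≤ ε * s := mul_nonneg hε.le hs
  have hsub : ε * t - ε * s = ε * (t - s) := by ring
  have h1 : Real.exp (lam * (ε * (t - s))) / 2 *
        dist (flowedCurve E lam ε γ t) (flowedCurve E lam ε γ s) ^ 2
      + expIntegral lam (ε * (t - s)) * ((E (flowedCurve E lam ε γ t)).toReal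
        - (E (flowedCurve E lam ε γ s)).toReal)
      + Real.exp (-(3 * |lam| * (ε * (t - s)))) * p ^ 2 * ((ε * (t - s)) ^ 2 / 2) ≤
      dist (eviSemigroup E lam (ε * s) (γ t)) (flowedCurve E lam ε γ s) ^ 2 / 2 := by
    -- The dissipation term needs a positive starting time; with p = 0 the plain `step` also covers
    -- s = 0.
    rcases hslope with rfl | ⟨hs0, hslope⟩
    · have h2 := hflow.step hE.ne_bot hεs hab hyE
      rw [hsub] at h2
      simp only [flowedCurve] at h2 ⊢
      linarith
    · have h2 := hflow.step_add_slope hE.ne_bot hE.lsc (mul_pos hε hs0) hab hp (Or.inr hslope) hyE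
      rw [hsub] at h2
      exact h2
  rw [dist_comm (flowedCurve E lam ε γ s)]
  refine h1.trans ?_
  have h3 := hE.dist_eviSemigroup_le hεs (γ t) (γ s)
  rw [dist_comm (γ t)] at h3
  have h4 : -(lam * (ε * s)) ≤ max (-lam) 0 * (ε * T) := by
    have h5 : ε * s ≤ ε * T := by nlinarith
    have h6 : -lam ≤ max (-lam) 0 := le_max_left _ _
    have h7 : 0 ≤ max (-lam) 0 := le_max_right _ _
    nlinarith
  have h8 : dist (eviSemigroup E lam (ε * s) (γ t)) (flowedCurve E lam ε γ s) ≤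
      Real.exp (max (-lam) 0 * (ε * T)) * dist (γ s) (γ t) :=
    h3.trans (mul_le_mul_of_nonneg_right (Real.exp_le_exp.2 h4) dist_nonneg)
  have h9 : Real.exp (2 * max (-lam) 0 * (ε * T)) = Real.exp (max (-lam) 0 * (ε * T)) ^ 2 := by
    rw [← Real.exp_nat_mul]; congr 1; push_cast; ring
  rw [h9]
  have h10 := pow_le_pow_left₀ dist_nonneg h8 2
  rw [mul_pow] at h10
  linarith

/-- Regularization: away from the initial time the slope is bounded along the flowed curve. -/
lemma exists_slope_bound_flowedCurve (hE : EVISetting E lam) (hε : 0 < ε) (h0 : E (γ 0) < ⊤)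
    (hγ : ContinuousOn γ (Set.Icc 0 T)) {δ : ℝ} (hδ : 0 < δ) :
    ∃ P : ℝ, 0 ≤ P ∧ ∀ t ∈ Set.Icc δ T, ∀ p, 0 ≤ p →
      GlobalSlopeGT E lam p (flowedCurve E lam ε γ t) → p ≤ P := by
  obtain ⟨c, hc⟩ := hE.bddBelow_of_isBounded _
    (isCompact_Icc.image_of_continuousOn (continuousOn_flowedCurve hE hε hγ)).isBounded
  obtain ⟨R, hR⟩ := isCompact_Icc.exists_bound_of_continuousOn
    (continuous_dist.comp_continuousOn (hγ.prodMk (continuousOn_const (c := γ 0))))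
  -- A lower bound, uniform in t ≥ δ, for both `expIntegral` over half of the flow time and the
  -- dissipation factor over the other half.
  set κ := Real.exp (-(|lam| * (ε * T))) * (ε * δ / 2) with hκ
  have hκ0 : 0 < κ := by positivity
  refine ⟨√(((E (γ 0)).toReal + R ^ 2 / 2 / κ - c) / κ), Real.sqrt_nonneg _,
    fun t ht p hp hslope => ?_⟩
  have ht0 : 0 < t := hδ.trans_le ht.1
  have htT : t ∈ Set.Icc 0 T := ⟨ht0.le, ht.2⟩
  have hflow := hE.isIntegralEVIFlow (γ t)
  have hεt : 0 < ε * t / 2 := by positivity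
  have hlow : c ≤ (E (flowedCurve E lam ε γ t)).toReal := by
    have h1 := hc _ (Set.mem_image_of_mem _ htT)
    rw [← EReal.coe_toReal (flowedCurve_lt_top hE hε h0 ht0.le).ne (hE.ne_bot _)] at h1
    exact_mod_cast h1
  -- The first half of the flow time, tested at γ_0, bounds the energy from above. The second half
  -- dissipates at least κp², which the lower bound c of the energy limits.
  have hhalf : ε * t - ε * t / 2 = ε * t / 2 := by ring
  have hdis := hflow.le_dissipation hE.ne_bot hE.lsc hεt (b := ε * t) (by linarith) hp
    (Or.inr hslope)
  rw [hhalf] at hdis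
  have hstep := hflow.step hE.ne_bot le_rfl hεt h0
  simp only [sub_zero, eviSemigroup_zero] at hstep
  have hd : dist (γ t) (γ 0) ^ 2 ≤ R ^ 2 := by
    have := hR t htT
    simp only [Function.comp, Real.norm_eq_abs, abs_of_nonneg dist_nonneg] at this
    exact pow_le_pow_left₀ dist_nonneg this 2
  have hεδ : ε * δ / 2 ≤ ε * t / 2 := by
    have := mul_le_mul_of_nonneg_left ht.1 hε.le
    linarith
  have hεT : ε * t ≤ ε * T := mul_le_mul_of_nonneg_left ht.2 hε.le
  have hIκ : κ ≤ expIntegral lam (ε * t / 2) := by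
    refine le_trans ?_ (exp_neg_mul_le_expIntegral lam hεt.le)
    rw [hκ]
    have : -(|lam| * (ε * T)) ≤ -(|lam| * (ε * t / 2)) := by
      have := mul_le_mul_of_nonneg_left (show ε * t / 2 ≤ ε * T by linarith) (abs_nonneg lam)
      linarith
    gcongr
  have hκ2 : κ ≤ Real.exp (-(2 * |lam| * (ε * t / 2))) * (ε * t / 2) := by
    rw [hκ]
    have : -(|lam| * (ε * T)) ≤ -(2 * |lam| * (ε * t / 2)) := by
      have := mul_le_mul_of_nonneg_left hεT (abs_nonneg lam)
      linarith
    gcongr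
  have hIpos := expIntegral_pos lam hεt
  have hup : (E (eviSemigroup E lam (ε * t / 2) (γ t))).toReal ≤
      (E (γ 0)).toReal + R ^ 2 / 2 / κ := by
    have h1 : 0 ≤ Real.exp (lam * (ε * t / 2)) / 2 *
        dist (eviSemigroup E lam (ε * t / 2) (γ t)) (γ 0) ^ 2 := by positivity
    have h2 : (E (eviSemigroup E lam (ε * t / 2) (γ t))).toReal - (E (γ 0)).toReal ≤
        R ^ 2 / 2 / expIntegral lam (ε * t / 2) := by
      rw [le_div_iff₀ hIpos]
      nlinarith
    have h3 : R ^ 2 / 2 / expIntegral lam (ε * t / 2) ≤ R ^ 2 / 2 / κ := by gcongr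
    linarith
  have hfin : p ^ 2 * κ ≤ (E (γ 0)).toReal + R ^ 2 / 2 / κ - c := by
    have h1 : p ^ 2 * κ ≤ Real.exp (-(2 * |lam| * (ε * t / 2))) * p ^ 2 * (ε * t / 2) := by
      have := mul_le_mul_of_nonneg_left hκ2 (sq_nonneg p)
      linarith
    simp only [flowedCurve] at hlow
    linarith
  rw [← le_div_iff₀ hκ0] at hfin
  exact (le_abs_self p).trans (Real.abs_le_sqrt hfin)

/-- `GlobalSlopeGT` fails at any p above the slope bound, and its negation is a global one-sided
Lipschitz estimate; the quadratic term is linear in the distance on a bounded set. -/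
lemma exists_energy_lipschitz_flowedCurve (hE : EVISetting E lam) (hε : 0 < ε) (h0 : E (γ 0) < ⊤)
    (hγ : ContinuousOn γ (Set.Icc 0 T)) {δ : ℝ} (hδ : 0 < δ) :
    ∃ P : ℝ, 0 ≤ P ∧ ∀ s ∈ Set.Icc δ T, ∀ t ∈ Set.Icc δ T,
      (E (flowedCurve E lam ε γ s)).toReal - (E (flowedCurve E lam ε γ t)).toReal ≤
        P * dist (flowedCurve E lam ε γ s) (flowedCurve E lam ε γ t) := by
  obtain ⟨P, hP0, hP⟩ := exists_slope_bound_flowedCurve hE hε h0 hγ hδ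
  obtain ⟨R, hR⟩ := Metric.isBounded_iff.1
    (isCompact_Icc.image_of_continuousOn (continuousOn_flowedCurve hE hε hγ)).isBounded
  refine ⟨P + 1 + |lam| / 2 * |R|, by positivity, fun s hs t ht => ?_⟩
  have hs' : s ∈ Set.Icc 0 T := ⟨hδ.le.trans hs.1, hs.2⟩
  have ht' : t ∈ Set.Icc 0 T := ⟨hδ.le.trans ht.1, ht.2⟩
  have h1 : ¬ GlobalSlopeGT E lam (P + 1) (flowedCurve E lam ε γ s) := fun h => by
    have := hP s hs (P + 1) (by linarith) h
    linarith
  simp only [GlobalSlopeGT, not_exists, not_and, not_lt] at h1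
  have h2 := h1 _ (flowedCurve_lt_top hE hε h0 ht'.1)
  set D := dist (flowedCurve E lam ε γ s) (flowedCurve E lam ε γ t) with hD
  have hD0 : 0 ≤ D := dist_nonneg
  have hDR : D ≤ |R| := (hR (Set.mem_image_of_mem _ hs') (Set.mem_image_of_mem _ ht')).trans
    (le_abs_self R)
  have h3 : -(lam / 2 * D ^ 2) ≤ |lam| / 2 * |R| * D := by
    have h4 : -(lam / 2 * D ^ 2) ≤ |lam| / 2 * D ^ 2 := by
      nlinarith [neg_abs_le lam, sq_nonneg D]
    have h5 : |lam| / 2 * D ^ 2 ≤ |lam| / 2 * (|R| * D) := by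
      have : D ^ 2 ≤ |R| * D := by nlinarith
      gcongr
    linarith
  linarith

/-- With energy differences bounded by P·D, where D = d(β_s, β_t), the two-point estimate becomes D²
≤ (A d(γ_s,γ_t))² + B(t - s)D, hence D ≤ A d(γ_s,γ_t) + B(t - s). -/
lemma absolutelyContinuousOnInterval_flowedCurve_of_pos (hE : EVISetting E lam) (hε : 0 < ε)
    (h0 : E (γ 0) < ⊤) (hT : 0 ≤ T) (hγ : AbsolutelyContinuousOnInterval γ 0 T) {δ : ℝ}
    (hδ : 0 < δ) (hδT : δ ≤ T) :
    AbsolutelyContinuousOnInterval (flowedCurve E lam ε γ) δ T := by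
  obtain ⟨P, hP0, hP⟩ := exists_energy_lipschitz_flowedCurve hE hε h0 (hγ.continuousOn_Icc hT) hδ
  set L := |lam| * (ε * T) with hL
  set C := Real.exp (2 * max (-lam) 0 * (ε * T)) with hC
  set A := √(Real.exp L * C) with hA
  set B := 2 * Real.exp (2 * L) * P * ε with hB
  have hB0 : 0 ≤ B := by positivity
  have key : ∀ s t, δ ≤ s → s < t → t ≤ T →
      dist (flowedCurve E lam ε γ s) (flowedCurve E lam ε γ t) ≤
        A * dist (γ s) (γ t) + B * dist s t := by
    intro s t hs hst ht
    have hs0 : 0 ≤ s := hδ.le.trans hs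
    have h1 := flowedCurve_two_point hE hε h0 hs0 hst ht le_rfl (Or.inl rfl)
    have h2 := hP s ⟨hs, hst.le.trans ht⟩ t ⟨hs.trans hst.le, ht⟩
    set D := dist (flowedCurve E lam ε γ s) (flowedCurve E lam ε γ t) with hD
    set g := dist (γ s) (γ t) with hg
    have hD0 : 0 ≤ D := dist_nonneg
    have hk0 : 0 < ε * (t - s) := mul_pos hε (sub_pos.2 hst)
    have hkT : ε * (t - s) ≤ ε * T := mul_le_mul_of_nonneg_left (by linarith) hε.le
    have hI0 := expIntegral_pos lam hk0
    have hlam := neg_abs_mul_le_mul lam hk0.le hkT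
    have hI : expIntegral lam (ε * (t - s)) ≤ Real.exp L * (ε * (t - s)) := by
      refine (expIntegral_le lam hk0.le).trans ?_
      have : |lam| * (ε * (t - s)) ≤ L := mul_le_mul_of_nonneg_left hkT (abs_nonneg lam)
      gcongr
    have hexp : Real.exp (-L) ≤ Real.exp (lam * (ε * (t - s))) := Real.exp_le_exp.2 hlam.1
    have h3 : Real.exp (-L) / 2 * D ^ 2 ≤ C / 2 * g ^ 2
        + Real.exp L * (ε * (t - s)) * (P * D) := by
      have h4 : Real.exp (-L) / 2 * D ^ 2 ≤ Real.exp (lam * (ε * (t - s))) / 2 * D ^ 2 := by gcongr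
      have h5 : expIntegral lam (ε * (t - s)) * ((E (flowedCurve E lam ε γ s)).toReal
          - (E (flowedCurve E lam ε γ t)).toReal) ≤ Real.exp L * (ε * (t - s)) * (P * D) :=
        (mul_le_mul_of_nonneg_left h2 hI0.le).trans
          (mul_le_mul_of_nonneg_right hI (by positivity))
      have h6 : Real.exp (-(3 * |lam| * (ε * (t - s)))) * (0 : ℝ) ^ 2
          * ((ε * (t - s)) ^ 2 / 2) = 0 := by ring
      linarith
    have h7 : D ^ 2 ≤ (A * g) ^ 2 + B * (t - s) * D := by
      have hLL : Real.exp L * Real.exp (-L) = 1 := by rw [← Real.exp_add]; simp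
      have hL2 : Real.exp (2 * L) = Real.exp L * Real.exp L := by rw [← Real.exp_add]; ring_nf
      have hA2 : A ^ 2 = Real.exp L * C := Real.sq_sqrt (by positivity)
      have h8 := mul_le_mul_of_nonneg_left h3 (Real.exp_pos L).le
      have h9 : Real.exp L * (Real.exp (-L) / 2 * D ^ 2) = D ^ 2 / 2 := by
        rw [← mul_assoc, ← mul_div_assoc, hLL]; ring
      rw [h9] at h8
      rw [mul_pow, hA2, hB, hL2]
      linarith
    have hdist : dist s t = t - s := by
      rw [dist_comm, Real.dist_eq, abs_of_pos (sub_pos.2 hst)]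
    rw [hdist]
    exact le_add_of_sq_le (by positivity) (mul_nonneg hB0 (sub_pos.2 hst).le) h7
  refine absolutelyContinuousOnInterval_of_dist_le (g := γ) (hγ.mono ?_) A B fun s hs t ht => ?_
  · rw [Set.uIcc_of_le hT, Set.uIcc_of_le hδT]; exact Set.Icc_subset_Icc_left hδ.le
  · rw [Set.uIcc_of_le hδT] at hs ht
    rcases lt_trichotomy s t with hst | rfl | hst
    · exact key s t hs.1 hst ht.2
    · simp
    · rw [dist_comm, dist_comm (γ s), dist_comm s]
      exact key t s ht.1 hst hs.2

lemma absolutelyContinuousOnInterval_energy_of_pos (hE : EVISetting E lam) (hε : 0 < ε)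
    (h0 : E (γ 0) < ⊤) (hT : 0 ≤ T) (hγ : AbsolutelyContinuousOnInterval γ 0 T) {δ : ℝ}
    (hδ : 0 < δ) (hδT : δ ≤ T) :
    AbsolutelyContinuousOnInterval (fun t => (E (flowedCurve E lam ε γ t)).toReal) δ T := by
  obtain ⟨P, hP0, hP⟩ := exists_energy_lipschitz_flowedCurve hE hε h0 (hγ.continuousOn_Icc hT) hδ
  refine absolutelyContinuousOnInterval_of_dist_le
    (absolutelyContinuousOnInterval_flowedCurve_of_pos hE hε h0 hT hγ hδ hδT) P 0
    fun s hs t ht => ?_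
  rw [Set.uIcc_of_le hδT] at hs ht
  rw [zero_mul, add_zero, Real.dist_eq, abs_le]
  have h1 := hP s hs t ht
  have h2 := hP t ht s hs
  rw [dist_comm] at h2
  constructor <;> linarith

end FlowedCurve

/-! ### Energy up to the initial time, and the pointwise speed-slope inequality -/

section FlowedCurve

variable {X : Type*} [MetricSpace X] {E : X → EReal} {lam ε T : ℝ} {γ : ℝ → X}

/-- The two-point estimate with p = 0, without its distance term; Cauchy–Schwarz for d²(γ_s,γ_t)
yields the factor t - s that cancels the one in `expIntegral`. Only upward increments are
controlled, but uniformly up to s = 0. -/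
lemma energy_flowedCurve_sub_le (hE : EVISetting E lam) (hε : 0 < ε) (h0 : E (γ 0) < ⊤)
    (hγ : AbsolutelyContinuousOnInterval γ 0 T)
    (hfin : ∫⁻ r in Set.Ioo 0 T, metricSpeed γ r ^ 2 ≠ ⊤) :
    ∃ C : ℝ, 0 ≤ C ∧ ∀ s t, 0 ≤ s → s ≤ t → t ≤ T →
      (E (flowedCurve E lam ε γ t)).toReal - (E (flowedCurve E lam ε γ s)).toReal ≤
        C * ∫ r in s..t, (metricSpeed γ r ^ 2).toReal := by
  set K := Real.exp (2 * max (-lam) 0 * (ε * T)) with hK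
  set L := Real.exp (-(|lam| * (ε * T))) with hL
  refine ⟨K / (2 * (L * ε)), by positivity, fun s t hs hst ht => ?_⟩
  rcases hst.eq_or_lt with rfl | hst
  · simp
  have hac : AbsolutelyContinuousOnInterval γ s t := hγ.mono (by
    rw [Set.uIcc_of_le hst.le, Set.uIcc_of_le (hs.trans (hst.le.trans ht))]
    exact Set.Icc_subset_Icc hs ht)
  have hfin' : ∫⁻ r in Set.Ioo s t, metricSpeed γ r ^ 2 ≠ ⊤ :=
    ne_top_of_le_ne_top hfin (lintegral_mono_set (Set.Ioo_subset_Ioo hs ht))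
  have h1 := flowedCurve_two_point hE hε h0 hs hst ht le_rfl (Or.inl rfl)
  have h2 := dist_sq_le_integral_metricSpeed_sq hst.le hac hfin'
  set J := ∫ r in s..t, (metricSpeed γ r ^ 2).toReal with hJ
  have hJ0 : 0 ≤ J := intervalIntegral.integral_nonneg hst.le fun _ _ => ENNReal.toReal_nonneg
  have hk0 : 0 < ε * (t - s) := mul_pos hε (sub_pos.2 hst)
  have hkT : ε * (t - s) ≤ ε * T := mul_le_mul_of_nonneg_left (by linarith) hε.le
  have hI : L * (ε * (t - s)) ≤ expIntegral lam (ε * (t - s)) := by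
    refine le_trans ?_ (exp_neg_mul_le_expIntegral lam hk0.le)
    have : |lam| * (ε * (t - s)) ≤ |lam| * (ε * T) :=
      mul_le_mul_of_nonneg_left hkT (abs_nonneg lam)
    rw [hL]
    gcongr
  set Δ := (E (flowedCurve E lam ε γ t)).toReal - (E (flowedCurve E lam ε γ s)).toReal with hΔ
  rcases le_total Δ 0 with hneg | hpos
  · exact hneg.trans (by positivity)
  have h3 : L * (ε * (t - s)) * Δ ≤ K / 2 * ((t - s) * J) := by
    have h4 := mul_le_mul_of_nonneg_right hI hpos
    have h5 : K / 2 * dist (γ s) (γ t) ^ 2 ≤ K / 2 * ((t - s) * J) := by gcongr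
    have h6 : 0 ≤ Real.exp (lam * (ε * (t - s))) / 2 *
        dist (flowedCurve E lam ε γ s) (flowedCurve E lam ε γ t) ^ 2 := by positivity
    have h7 : Real.exp (-(3 * |lam| * (ε * (t - s)))) * (0 : ℝ) ^ 2
          * ((ε * (t - s)) ^ 2 / 2) = 0 := by ring
    linarith
  have h8 : L * ε * Δ ≤ K / 2 * J := by
    refine le_of_mul_le_mul_right ?_ (sub_pos.2 hst)
    linarith
  have h9 : 0 < L * ε := by positivity
  rw [div_mul_eq_mul_div, le_div_iff₀ (by positivity)]
  linarith

/-- The energy is absolutely continuous along the flowed curve, up to the initial time. -/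
lemma absolutelyContinuousOnInterval_energy (hE : EVISetting E lam) (hε : 0 < ε)
    (h0 : E (γ 0) < ⊤) (hT : 0 < T) (hγ : AbsolutelyContinuousOnInterval γ 0 T)
    (hfin : ∫⁻ r in Set.Ioo 0 T, metricSpeed γ r ^ 2 ≠ ⊤) :
    AbsolutelyContinuousOnInterval (fun t => (E (flowedCurve E lam ε γ t)).toReal) 0 T := by
  obtain ⟨C, hC0, hC⟩ := energy_flowedCurve_sub_le hE hε h0 hγ hfin
  have hint : IntervalIntegrable (fun r => (metricSpeed γ r ^ 2).toReal) volume 0 T :=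
    intervalIntegrable_toReal_Ioo hT.le
      ((aemeasurable_metricSpeed hT.le (hγ.continuousOn_Icc hT.le)).pow_const 2) hfin
  have hsub : ∀ s t, 0 ≤ s → s ≤ t → t ≤ T →
      IntervalIntegrable (fun r => (metricSpeed γ r ^ 2).toReal) volume s t :=
    fun s t hs hst ht => hint.mono_set (by
      rw [Set.uIcc_of_le hst, Set.uIcc_of_le hT.le]; exact Set.Icc_subset_Icc hs ht)
  set J : ℝ → ℝ := fun t => C * ∫ r in (0 : ℝ)..t, (metricSpeed γ r ^ 2).toReal with hJ
  set F : ℝ → ℝ := fun t => (E (flowedCurve E lam ε γ t)).toReal with hF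
  have hJac : AbsolutelyContinuousOnInterval J 0 T :=
    (hint.absolutelyContinuousOnInterval_intervalIntegral (c := 0) Set.left_mem_uIcc).const_mul C
  have hJlim : Tendsto J (𝓝[>] 0) (𝓝 0) := by
    have h := (tendsto_primitive_nhdsGT hT hint).const_mul C
    rwa [mul_zero] at h
  have hF0 : Tendsto F (𝓝[>] 0) (𝓝 (F 0)) := by
    rw [tendsto_order]
    refine ⟨fun c hc => ?_, fun c hc => ?_⟩
    · have h1 : (c : EReal) < E (flowedCurve E lam ε γ 0) := by
        rwa [← EReal.coe_toReal (flowedCurve_lt_top hE hε h0 le_rfl).ne (hE.ne_bot _),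
          EReal.coe_lt_coe_iff]
      have h2 : Tendsto (flowedCurve E lam ε γ) (𝓝[>] 0) (𝓝 (flowedCurve E lam ε γ 0)) :=
        (continuousOn_flowedCurve hE hε (hγ.continuousOn_Icc hT.le) 0
          (Set.left_mem_Icc.2 hT.le)).mono_left (nhdsWithin_le_of_mem
            (mem_of_superset (Ioo_mem_nhdsGT hT) Set.Ioo_subset_Icc_self))
      filter_upwards [h2.eventually (hE.lsc _ c h1), self_mem_nhdsWithin] with r hr hr0
      change (c : EReal) < E (flowedCurve E lam ε γ r) at hr
      rwa [← EReal.coe_toReal (flowedCurve_lt_top hE hε h0 (le_of_lt hr0)).ne (hE.ne_bot _),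
        EReal.coe_lt_coe_iff] at hr
    · filter_upwards [hJlim.eventually (gt_mem_nhds (sub_pos.2 hc)), Ioo_mem_nhdsGT hT]
        with r hr hrT
      have := hC 0 r le_rfl hrT.1.le hrT.2.le
      simp only [hJ, hF] at hr ⊢
      linarith
  -- The one-sided bound says exactly that J - F is nondecreasing.
  have hG : AbsolutelyContinuousOnInterval (fun t => J t - F t) 0 T := by
    refine absolutelyContinuousOnInterval_of_monotoneOn hT.le ?_ ?_ ?_
    · intro s hs t ht hst
      have h1 := hC s t hs.1 hst ht.2
      rw [← intervalIntegral.integral_interval_sub_left (hsub 0 t le_rfl ht.1 ht.2)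
        (hsub 0 s le_rfl hs.1 hs.2)] at h1
      simp only [hJ, hF]
      linarith
    · intro δ hδ hδT
      exact (hJac.mono (by
        rw [Set.uIcc_of_le hδT, Set.uIcc_of_le hT.le]
        exact Set.Icc_subset_Icc_left hδ.le)).fun_sub
          (absolutelyContinuousOnInterval_energy_of_pos hE hε h0 hT.le hγ hδ hδT)
    · have : J 0 = 0 := by simp [hJ]
      rw [this]
      exact hJlim.sub hF0
  have := hJac.fun_sub hG
  simpa using this

/-- Speed, slope and energy of the flowed curve at a point of differentiability of the energy. -/
lemma sq_add_sq_le_of_lt (hE : EVISetting E lam) (hε : 0 < ε) (h0 : E (γ 0) < ⊤)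
    (hγ : ContinuousOn γ (Set.Icc 0 T)) {t : ℝ} (ht : t ∈ Set.Ioo 0 T)
    (hF : DifferentiableAt ℝ (fun t => (E (flowedCurve E lam ε γ t)).toReal) t)
    (hm : metricSpeed γ t ≠ ⊤) {q p : ℝ} (hq : 0 ≤ q) (hp : 0 ≤ p)
    (hq' : q = 0 ∨ ENNReal.ofReal q < metricSpeed (flowedCurve E lam ε γ) t)
    (hp' : p = 0 ∨ ENNReal.ofReal p < metricSlope E (flowedCurve E lam ε γ t)) :
    q ^ 2 + ε ^ 2 * p ^ 2 ≤
      Real.exp (2 * max (-lam) 0 * (ε * T)) * (metricSpeed γ t ^ 2).toReal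
        - 2 * ε * deriv (fun t => (E (flowedCurve E lam ε γ t)).toReal) t := by
  set β := flowedCurve E lam ε γ with hβ
  set F : ℝ → ℝ := fun t => (E (β t)).toReal with hFdef
  set C := Real.exp (2 * max (-lam) 0 * (ε * T)) with hC
  set m := (metricSpeed γ t).toReal with hmdef
  have hβt : ContinuousAt β t := (continuousOn_flowedCurve hE hε hγ).continuousAt
    (Icc_mem_nhds ht.1 ht.2)
  -- For s > t the two-point estimate sees the slope at β_s rather than β_t. A fixed competitor y
  -- remains valid nearby because E∘β is continuous at t.
  have hslope : ∀ᶠ s in 𝓝[≠] t, p = 0 ∨ GlobalSlopeGT E lam p (β s) := by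
    rcases hp' with hp' | hp'
    · exact Eventually.of_forall fun _ => Or.inl hp'
    obtain ⟨y, hy, hlt⟩ := globalSlopeGT_of_lt_metricSlope (lam := lam) hE.ne_bot
      (flowedCurve_lt_top hE hε h0 ht.1.le) hp hp'
    have hd : Tendsto (fun s => dist (β s) y) (𝓝 t) (𝓝 (dist (β t) y)) :=
      hβt.tendsto.dist tendsto_const_nhds
    have h1 : Tendsto (fun s => F s + lam / 2 * dist (β s) y ^ 2
        - ((E y).toReal + p * dist (β s) y)) (𝓝 t) (𝓝 (F t + lam / 2 * dist (β t) y ^ 2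
        - ((E y).toReal + p * dist (β t) y))) :=
      (hF.continuousAt.tendsto.add ((hd.pow 2).const_mul _)).sub
        (tendsto_const_nhds.add (hd.const_mul p))
    filter_upwards [(h1.eventually (lt_mem_nhds (sub_pos.2 hlt))).filter_mono nhdsWithin_le_nhds]
      with s hs
    exact Or.inr ⟨y, hy, sub_pos.1 hs⟩
  have hslopet : p = 0 ∨ GlobalSlopeGT E lam p (β t) := hp'.imp_right fun h =>
    globalSlopeGT_of_lt_metricSlope hE.ne_bot (flowedCurve_lt_top hE hε h0 ht.1.le) hp h
  -- The upper limit supplies only frequent times, on an unspecified side of t; every other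
  -- condition holds eventually.
  have hfreq : ∃ᶠ s in 𝓝[≠] t, q * |s - t| ≤ dist (β s) (β t) := by
    rcases hq' with rfl | hq'
    · exact (Eventually.of_forall fun s => by rw [zero_mul]; exact dist_nonneg).frequently
    refine ((frequently_lt_of_lt_limsup (by isBoundedDefault) hq').and_eventually
      self_mem_nhdsWithin).mono fun s hs => ?_
    obtain ⟨hs, hst⟩ := hs
    have hpos : 0 < dist s t := dist_pos.2 hst
    have hed : edist s t ≠ 0 := by rw [edist_dist]; simpa using hpos
    rw [ENNReal.lt_div_iff_mul_lt (Or.inl hed) (Or.inl (edist_ne_top s t)), edist_dist, edist_dist,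
      ← ENNReal.ofReal_mul hq] at hs
    have := (ENNReal.ofReal_lt_ofReal_iff_of_nonneg (by positivity)).1 hs
    rw [Real.dist_eq] at this
    exact this.le
  -- The slack κ covers the first-order errors of both F and the speed of γ; it is sent to 0 after
  -- the limit s → t.
  have key : ∀ κ : ℝ, 0 < κ →
      q ^ 2 / 2 + ε * (deriv F t - κ) + p ^ 2 * (ε ^ 2 / 2) ≤ C / 2 * (m + κ) ^ 2 := by
    intro κ hκ
    have hspeed : ∀ᶠ s in 𝓝[≠] t, dist (γ s) (γ t) ≤ (m + κ) * |s - t| := by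
      have h1 : metricSpeed γ t < ENNReal.ofReal (m + κ) := by
        rw [← ENNReal.ofReal_toReal hm]
        exact (ENNReal.ofReal_lt_ofReal_iff (by positivity)).2 (by linarith)
      filter_upwards [eventually_lt_of_limsup_lt h1, self_mem_nhdsWithin] with s hs hst
      have hpos : 0 < dist s t := dist_pos.2 hst
      have hed : edist s t ≠ 0 := by rw [edist_dist]; simpa using hpos
      rw [ENNReal.div_lt_iff (Or.inl hed) (Or.inl (edist_ne_top s t)), edist_dist, edist_dist,
        ← ENNReal.ofReal_mul (by positivity)] at hs
      have := (ENNReal.ofReal_lt_ofReal_iff_of_nonneg dist_nonneg).1 hs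
      rw [Real.dist_eq s t] at this
      exact this.le
    have hder : ∀ᶠ s in 𝓝[≠] t, |F s - F t - deriv F t * (s - t)| ≤ κ * |s - t| := by
      have h1 := hF.hasDerivAt.isLittleO.def hκ
      filter_upwards [h1.filter_mono nhdsWithin_le_nhds] with s hs
      simpa [mul_comm] using hs
    have hk : Tendsto (fun s : ℝ => |s - t|) (𝓝[≠] t) (𝓝[>] 0) := by
      refine tendsto_nhdsWithin_iff.2 ⟨?_, ?_⟩
      · have : Tendsto (fun s : ℝ => |s - t|) (𝓝 t) (𝓝 |t - t|) :=
          Continuous.tendsto (by fun_prop) t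
        rw [sub_self, abs_zero] at this
        exact this.mono_left nhdsWithin_le_nhds
      · filter_upwards [self_mem_nhdsWithin] with s hs
        exact Set.mem_Ioi.2 (abs_pos.2 (sub_ne_zero.2 hs))
    have hψ : Tendsto (fun k : ℝ => Real.exp (lam * (ε * k)) / 2 * q ^ 2
        + ε * (expIntegral lam (ε * k) / (ε * k)) * (deriv F t - κ)
        + Real.exp (-(3 * |lam| * (ε * k))) * p ^ 2 * (ε ^ 2 / 2)) (𝓝[>] 0)
        (𝓝 (q ^ 2 / 2 + ε * (deriv F t - κ) + p ^ 2 * (ε ^ 2 / 2))) := by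
      have h1 : Tendsto (fun k : ℝ => Real.exp (lam * (ε * k)) / 2 * q ^ 2) (𝓝[>] 0)
          (𝓝 (Real.exp (lam * (ε * 0)) / 2 * q ^ 2)) :=
        (Continuous.tendsto (by fun_prop) 0).mono_left nhdsWithin_le_nhds
      have h2 : Tendsto (fun k : ℝ => Real.exp (-(3 * |lam| * (ε * k))) * p ^ 2 * (ε ^ 2 / 2))
          (𝓝[>] 0) (𝓝 (Real.exp (-(3 * |lam| * (ε * 0))) * p ^ 2 * (ε ^ 2 / 2))) :=
        (Continuous.tendsto (by fun_prop) 0).mono_left nhdsWithin_le_nhds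
      have h3 : Tendsto (fun k : ℝ => ε * k) (𝓝[>] 0) (𝓝[>] 0) := by
        refine tendsto_nhdsWithin_iff.2 ⟨?_, ?_⟩
        · have : Tendsto (fun k : ℝ => ε * k) (𝓝 0) (𝓝 (ε * 0)) :=
            Continuous.tendsto (by fun_prop) 0
          rw [mul_zero] at this
          exact this.mono_left nhdsWithin_le_nhds
        · filter_upwards [self_mem_nhdsWithin] with k hk
          exact Set.mem_Ioi.2 (mul_pos hε hk)
      have h4 := (((tendsto_expIntegral_div lam).comp h3).const_mul ε).mul_const (deriv F t - κ)
      have h5 := (h1.add h4).add h2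
      simp only [mul_zero, Real.exp_zero, neg_zero, one_mul, mul_one, Function.comp] at h5
      rwa [show 1 / 2 * q ^ 2 = q ^ 2 / 2 by ring] at h5
    refine le_of_tendsto_of_frequently (hψ.comp hk) ?_
    have hev : ∀ᶠ s in 𝓝[≠] t, s ∈ Set.Ioo 0 T :=
      (isOpen_Ioo.mem_nhds ht : Set.Ioo 0 T ∈ 𝓝 t) |> fun h => nhdsWithin_le_nhds h
    refine (hfreq.and_eventually (hslope.and (hspeed.and (hder.and (hev.and
      self_mem_nhdsWithin))))).mono fun s hs => ?_
    obtain ⟨hqs, hps, hms, hFs, hsT, hst⟩ := hs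
    have hk0 : 0 < |s - t| := abs_pos.2 (sub_ne_zero.2 hst)
    have hmain : Real.exp (lam * (ε * |s - t|)) / 2 * dist (β s) (β t) ^ 2
        + expIntegral lam (ε * |s - t|) * ((deriv F t - κ) * |s - t|)
        + Real.exp (-(3 * |lam| * (ε * |s - t|))) * p ^ 2 * ((ε * |s - t|) ^ 2 / 2) ≤
        C / 2 * dist (γ s) (γ t) ^ 2 := by
      have hI := expIntegral_pos lam (mul_pos hε hk0)
      rw [abs_le] at hFs
      rcases lt_or_gt_of_ne hst with hlt | hlt
      · have habs : |s - t| = t - s := by rw [abs_sub_comm, abs_of_pos (sub_pos.2 hlt)]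
        rw [habs] at hFs hI ⊢
        have h1 := flowedCurve_two_point (T := T) hE hε h0 hsT.1.le hlt ht.2.le hp
          (hslopet.imp_right fun h => ⟨hsT.1, h⟩)
        refine le_trans ?_ h1
        have h2 : (deriv F t - κ) * (t - s) ≤ F t - F s := by linarith [hFs.2]
        have h3 := mul_le_mul_of_nonneg_left h2 hI.le
        gcongr
      · have habs : |s - t| = s - t := abs_of_pos (sub_pos.2 hlt)
        rw [habs] at hFs hI ⊢
        have h1 := flowedCurve_two_point (T := T) hE hε h0 ht.1.le hlt hsT.2.le hp
          (hps.imp_right fun h => ⟨ht.1, h⟩)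
        rw [dist_comm (β s), dist_comm (γ s)]
        refine le_trans ?_ h1
        have h2 : (deriv F t - κ) * (s - t) ≤ F s - F t := by linarith [hFs.1]
        have h3 := mul_le_mul_of_nonneg_left h2 hI.le
        gcongr
    simp only [Function.comp]
    set k := |s - t| with hkdef
    have h4 : (q * k) ^ 2 ≤ dist (β s) (β t) ^ 2 := by gcongr
    have h5 : dist (γ s) (γ t) ^ 2 ≤ ((m + κ) * k) ^ 2 := by gcongr
    have h6 : Real.exp (lam * (ε * k)) / 2 * (q * k) ^ 2
        + expIntegral lam (ε * k) * ((deriv F t - κ) * k)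
        + Real.exp (-(3 * |lam| * (ε * k))) * p ^ 2 * ((ε * k) ^ 2 / 2) ≤
        C / 2 * ((m + κ) * k) ^ 2 := by
      refine le_trans ?_ (hmain.trans ?_)
      · gcongr
      · gcongr
    refine le_of_mul_le_mul_right ?_ (pow_pos hk0 2)
    refine le_trans (le_of_eq ?_) (h6.trans (le_of_eq ?_))
    · field_simp
    · ring
  have hlimL : Tendsto (fun κ : ℝ => C / 2 * (m + κ) ^ 2
      - (q ^ 2 / 2 + ε * (deriv F t - κ) + p ^ 2 * (ε ^ 2 / 2))) (𝓝[>] 0)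
      (𝓝 (C / 2 * (m + 0) ^ 2 - (q ^ 2 / 2 + ε * (deriv F t - 0) + p ^ 2 * (ε ^ 2 / 2)))) :=
    (Continuous.tendsto (by fun_prop) 0).mono_left nhdsWithin_le_nhds
  have hfinal := ge_of_tendsto hlimL (by
    filter_upwards [self_mem_nhdsWithin] with κ hκ
    exact sub_nonneg.2 (key κ hκ))
  rw [ENNReal.toReal_pow]
  rw [add_zero, sub_zero] at hfinal
  linarith

end FlowedCurve

lemma aemeasurable_metricSlope_comp {X : Type*} [MetricSpace X] {E : X → EReal}
    (hlsc : LowerSemicontinuous E) (hbot : ∀ x, E x ≠ ⊥) {β : ℝ → X} {a b : ℝ} (hab : a ≤ b)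
    (hβ : ContinuousOn β (Set.Icc a b)) (hfin : ∀ t ∈ Set.Icc a b, E (β t) < ⊤) :
    AEMeasurable (fun t => metricSlope E (β t)) (volume.restrict (Set.Ioo a b)) := by
  borelize X
  refine ⟨_, (measurable_limsup_toENNReal_sub_div hlsc hbot).comp
    (continuous_comp_projIcc hab hβ).measurable, ?_⟩
  filter_upwards [ae_restrict_mem measurableSet_Ioo] with t ht
  have ht' := Set.Ioo_subset_Icc_self ht
  simp only [Function.comp]
  rw [Set.projIcc_of_mem hab ht']
  exact if_pos (hfin t ht')

/-- The conclusion of the regularization theorem for the curve `t ↦ S_{ε t} γ_t`. -/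
lemma flowedCurve_estimate {X : Type*} [MetricSpace X] {E : X → EReal} {lam ε T : ℝ} {γ : ℝ → X}
    (hE : EVISetting E lam) (hε : 0 < ε) (h0 : E (γ 0) < ⊤) (hT : 0 < T)
    (hγ : AbsolutelyContinuousOnInterval γ 0 T)
    (hfin : ∫⁻ r in Set.Ioo 0 T, metricSpeed γ r ^ 2 ≠ ⊤) :
    AbsolutelyContinuousOnInterval (flowedCurve E lam ε γ) 0 T ∧
    ∫⁻ r in Set.Ioo 0 T, metricSpeed (flowedCurve E lam ε γ) r ^ 2 ≠ ⊤ ∧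
    ∫⁻ r in Set.Ioo 0 T, metricSlope E (flowedCurve E lam ε γ r) ^ 2 ≠ ⊤ ∧
    (∫⁻ r in Set.Ioo 0 T, metricSpeed (flowedCurve E lam ε γ) r ^ 2).toReal
      + ε ^ 2 * (∫⁻ r in Set.Ioo 0 T, metricSlope E (flowedCurve E lam ε γ r) ^ 2).toReal ≤
    Real.exp (2 * max (-lam) 0 * (ε * T)) * (∫⁻ r in Set.Ioo 0 T, metricSpeed γ r ^ 2).toReal
      - 2 * ε * ((E (flowedCurve E lam ε γ T)).toReal - (E (γ 0)).toReal) := by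
  set β := flowedCurve E lam ε γ with hβ
  set F : ℝ → ℝ := fun t => (E (β t)).toReal with hF
  set C := Real.exp (2 * max (-lam) 0 * (ε * T)) with hC
  have hγc := hγ.continuousOn_Icc hT.le
  have hβc : ContinuousOn β (Set.Icc 0 T) := continuousOn_flowedCurve hE hε hγc
  have hmγ : AEMeasurable (fun r => metricSpeed γ r ^ 2) (volume.restrict (Set.Ioo 0 T)) :=
    (aemeasurable_metricSpeed hT.le hγc).pow_const 2
  have hmβ : AEMeasurable (fun r => metricSpeed β r ^ 2) (volume.restrict (Set.Ioo 0 T)) :=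
    (aemeasurable_metricSpeed hT.le hβc).pow_const 2
  have hFac : AbsolutelyContinuousOnInterval F 0 T :=
    absolutelyContinuousOnInterval_energy hE hε h0 hT hγ hfin
  have hae : ∀ᵐ t ∂volume.restrict (Set.Ioo 0 T), DifferentiableAt ℝ F t ∧ metricSpeed γ t ≠ ⊤ := by
    have h1 : ∀ᵐ t ∂volume.restrict (Set.Ioo 0 T), DifferentiableAt ℝ F t := by
      rw [ae_restrict_iff' measurableSet_Ioo]
      filter_upwards [hFac.ae_differentiableAt] with t ht ht'
      exact ht (by rw [Set.uIcc_of_le hT.le]; exact Set.Ioo_subset_Icc_self ht')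
    filter_upwards [h1, ae_lt_top' hmγ hfin] with t h2 h3
    refine ⟨h2, fun h4 => ?_⟩
    simp [h4] at h3
  set R : ℝ → ℝ := fun t => C * (metricSpeed γ t ^ 2).toReal - 2 * ε * deriv F t with hR
  -- Nonnegativity of R, the case q = p = 0, permits the passage from its Bochner integral to a
  -- lower Lebesgue integral.
  have hpt : ∀ᵐ t ∂volume.restrict (Set.Ioo 0 T), 0 ≤ R t ∧
      metricSpeed β t ^ 2 + ENNReal.ofReal (ε ^ 2) * metricSlope E (β t) ^ 2 ≤
        ENNReal.ofReal (R t) := by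
    filter_upwards [hae, ae_restrict_mem measurableSet_Ioo] with t ht htT
    have h1 : ∀ q p : ℝ, 0 ≤ q → 0 ≤ p → (q = 0 ∨ ENNReal.ofReal q < metricSpeed β t) →
        (p = 0 ∨ ENNReal.ofReal p < metricSlope E (β t)) → q ^ 2 + ε ^ 2 * p ^ 2 ≤ R t :=
      fun q p hq hp hq' hp' => sq_add_sq_le_of_lt hE hε h0 hγc htT ht.1 ht.2 hq hp hq' hp'
    exact ⟨by simpa using h1 0 0 le_rfl le_rfl (Or.inl rfl) (Or.inl rfl),
      ENNReal.sq_add_mul_sq_le_ofReal hε h1⟩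
  have hi1 : IntervalIntegrable (fun r => (metricSpeed γ r ^ 2).toReal) volume 0 T :=
    intervalIntegrable_toReal_Ioo hT.le hmγ hfin
  have hi2 := hFac.intervalIntegrable_deriv
  have hRint : IntervalIntegrable R volume 0 T := (hi1.const_mul C).sub (hi2.const_mul (2 * ε))
  have hRval : ∫ t in Set.Ioo 0 T, R t =
      C * (∫⁻ r in Set.Ioo 0 T, metricSpeed γ r ^ 2).toReal - 2 * ε * (F T - F 0) := by
    rw [setIntegral_congr_set Ioo_ae_eq_Ioc, ← intervalIntegral.integral_of_le hT.le,
      intervalIntegral.integral_sub (hi1.const_mul C) (hi2.const_mul (2 * ε)),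
      intervalIntegral.integral_const_mul, intervalIntegral.integral_const_mul,
      hFac.integral_deriv_eq_sub, setIntegral_toReal_Ioo hT.le hmγ hfin]
  have hsum : (∫⁻ r in Set.Ioo 0 T, metricSpeed β r ^ 2)
      + ENNReal.ofReal (ε ^ 2) * ∫⁻ r in Set.Ioo 0 T, metricSlope E (β r) ^ 2 ≤
        ENNReal.ofReal (∫ t in Set.Ioo 0 T, R t) := by
    rw [ofReal_integral_eq_lintegral_ofReal
      ((intervalIntegrable_iff_integrableOn_Ioo_of_le hT.le).1 hRint) (hpt.mono fun _ h => h.1),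
      ← lintegral_const_mul' _ _ ENNReal.ofReal_ne_top, ← lintegral_add_left' hmβ]
    exact lintegral_mono_ae (hpt.mono fun _ h => h.2)
  have hR0 : 0 ≤ ∫ t in Set.Ioo 0 T, R t := integral_nonneg_of_ae (hpt.mono fun _ h => h.1)
  have hsum_top := ne_top_of_le_ne_top ENNReal.ofReal_ne_top hsum
  have htop1 : ∫⁻ r in Set.Ioo 0 T, metricSpeed β r ^ 2 ≠ ⊤ :=
    ne_top_of_le_ne_top hsum_top le_self_add
  have htop2' : ENNReal.ofReal (ε ^ 2) * ∫⁻ r in Set.Ioo 0 T, metricSlope E (β r) ^ 2 ≠ ⊤ :=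
    ne_top_of_le_ne_top hsum_top le_add_self
  have htop2 : ∫⁻ r in Set.Ioo 0 T, metricSlope E (β r) ^ 2 ≠ ⊤ := fun h => by
    rw [h, ENNReal.mul_top (by simpa using hε.ne')] at htop2'
    exact htop2' rfl
  refine ⟨?_, htop1, htop2, ?_⟩
  -- Absolute continuity of β is known away from 0, where its length controls distances. The speed
  -- being integrable up to 0, continuity of β extends this control to the initial time.
  · have hspeed := lintegral_metricSpeed_ne_top htop1
    have hint : IntervalIntegrable (fun r => (metricSpeed β r).toReal) volume 0 T :=
      intervalIntegrable_toReal_Ioo hT.le (aemeasurable_metricSpeed hT.le hβc) hspeed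
    have hsub : ∀ s t, 0 ≤ s → s ≤ t → t ≤ T →
        IntervalIntegrable (fun r => (metricSpeed β r).toReal) volume s t :=
      fun s t hs hst ht => hint.mono_set (by
        rw [Set.uIcc_of_le hst, Set.uIcc_of_le hT.le]; exact Set.Icc_subset_Icc hs ht)
    have hpos : ∀ s t, 0 < s → s ≤ t → t ≤ T →
        dist (β s) (β t) ≤ ∫ r in s..t, (metricSpeed β r).toReal := by
      intro s t hs hst ht
      refine dist_le_integral_metricSpeed hst
        ((absolutelyContinuousOnInterval_flowedCurve_of_pos hE hε h0 hT.le hγ hs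
          (hst.trans ht)).mono ?_)
        (ne_top_of_le_ne_top hspeed (lintegral_mono_set (Set.Ioo_subset_Ioo hs.le ht)))
      rw [Set.uIcc_of_le hst, Set.uIcc_of_le (hst.trans ht)]
      exact Set.Icc_subset_Icc_right ht
    refine absolutelyContinuousOnInterval_of_dist_le_integral hT.le hint fun s t hs hst ht => ?_
    rcases hs.eq_or_lt with rfl | hs
    · rcases hst.eq_or_lt with rfl | hst
      · simp
      have h1 : Tendsto (fun s => dist (β s) (β t)) (𝓝[>] 0) (𝓝 (dist (β 0) (β t))) :=
        ((hβc 0 (Set.left_mem_Icc.2 hT.le)).mono_left (nhdsWithin_le_of_mem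
          (mem_of_superset (Ioo_mem_nhdsGT hT) Set.Ioo_subset_Icc_self))).dist tendsto_const_nhds
      have h2 := (tendsto_const_nhds (x := ∫ r in (0 : ℝ)..t, (metricSpeed β r).toReal)).sub
        (tendsto_primitive_nhdsGT hT hint)
      rw [sub_zero] at h2
      refine le_of_tendsto_of_tendsto h1 h2 ?_
      filter_upwards [Ioo_mem_nhdsGT hst] with s hs
      rw [intervalIntegral.integral_interval_sub_left (hsub 0 t le_rfl hst.le ht)
        (hsub 0 s le_rfl hs.1.le (hs.2.le.trans ht))]
      exact hpos s t hs.1 hs.2.le ht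
    · exact hpos s t hs hst ht
  · have h1 := ENNReal.toReal_mono ENNReal.ofReal_ne_top hsum
    rw [ENNReal.toReal_ofReal hR0, hRval, ENNReal.toReal_add htop1 htop2', ENNReal.toReal_mul,
      ENNReal.toReal_ofReal (by positivity)] at h1
    have h2 : F 0 = (E (γ 0)).toReal := by simp [hF, hβ, flowedCurve]
    rwa [h2] at h1

/-! ### Reversal and concatenation of curves -/

/-- Oscillations of `f` on `[a, b]` are bounded by the integral of an integrable function. -/
def DistLeIntegral {Y : Type*} [PseudoMetricSpace Y] (f : ℝ → Y) (a b : ℝ) : Prop :=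
  ∃ m : ℝ → ℝ, IntervalIntegrable m volume a b ∧
    ∀ s t, a ≤ s → s ≤ t → t ≤ b → dist (f s) (f t) ≤ ∫ r in s..t, m r

namespace DistLeIntegral

variable {Y : Type*} [PseudoMetricSpace Y] {f g : ℝ → Y} {a b c : ℝ}

lemma absolutelyContinuousOnInterval (h : DistLeIntegral f a b) (hab : a ≤ b) :
    AbsolutelyContinuousOnInterval f a b :=
  let ⟨_, hm, hd⟩ := h
  absolutelyContinuousOnInterval_of_dist_le_integral hab hm hd

lemma congr (h : DistLeIntegral f a b) (hfg : Set.EqOn f g (Set.Icc a b)) :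
    DistLeIntegral g a b := by
  obtain ⟨m, hm, hd⟩ := h
  refine ⟨m, hm, fun s t hs hst ht => ?_⟩
  rw [← hfg ⟨hs, hst.trans ht⟩, ← hfg ⟨hs.trans hst, ht⟩]
  exact hd s t hs hst ht

lemma comp_const_sub (h : DistLeIntegral f a b) (c : ℝ) :
    DistLeIntegral (fun t => f (c - t)) (c - b) (c - a) := by
  obtain ⟨m, hm, hd⟩ := h
  refine ⟨fun r => m (c - r), (hm.comp_sub_left c).symm, fun s t hs hst ht => ?_⟩
  rw [intervalIntegral.integral_comp_sub_left m c, dist_comm]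
  exact hd _ _ (by linarith) (by linarith) (by linarith)

lemma trans (h₁ : DistLeIntegral f a b) (h₂ : DistLeIntegral f b c) (hab : a ≤ b) (hbc : b ≤ c) :
    DistLeIntegral f a c := by
  obtain ⟨m₁, hm₁, hd₁⟩ := h₁
  obtain ⟨m₂, hm₂, hd₂⟩ := h₂
  set m : ℝ → ℝ := fun r => if r ≤ b then m₁ r else m₂ r with hm
  have hleft : ∀ s t, s ≤ t → t ≤ b → Set.EqOn m₁ m (Set.uIoc s t) := by
    intro s t hst htb r hr
    rw [Set.uIoc_of_le hst] at hr
    simp [hm, hr.2.trans htb]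
  have hright : ∀ s t, b ≤ s → s ≤ t → Set.EqOn m₂ m (Set.uIoc s t) := by
    intro s t hbs hst r hr
    rw [Set.uIoc_of_le hst] at hr
    simp [hm, not_le.2 (hbs.trans_lt hr.1)]
  have hi₁ : IntervalIntegrable m volume a b := hm₁.congr (hleft a b hab le_rfl)
  have hi₂ : IntervalIntegrable m volume b c := hm₂.congr (hright b c le_rfl hbc)
  have e₁ : ∀ s t, a ≤ s → s ≤ t → t ≤ b → dist (f s) (f t) ≤ ∫ r in s..t, m r :=
    fun s t hs hst ht => (hd₁ s t hs hst ht).trans_eq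
      (intervalIntegral.integral_congr_ae (Eventually.of_forall fun r hr => hleft s t hst ht hr))
  have e₂ : ∀ s t, b ≤ s → s ≤ t → t ≤ c → dist (f s) (f t) ≤ ∫ r in s..t, m r :=
    fun s t hs hst ht => (hd₂ s t hs hst ht).trans_eq
      (intervalIntegral.integral_congr_ae (Eventually.of_forall fun r hr => hright s t hs hst hr))
  refine ⟨m, hi₁.trans hi₂, fun s t hs hst ht => ?_⟩
  rcases le_total t b with htb | htb
  · exact e₁ s t hs hst htb
  rcases le_total b s with hbs | hbs
  · exact e₂ s t hbs hst ht
  rw [← intervalIntegral.integral_add_adjacent_intervals (b := b)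
    (hi₁.mono_set (by
      rw [Set.uIcc_of_le hbs, Set.uIcc_of_le hab]; exact Set.Icc_subset_Icc_left hs))
    (hi₂.mono_set (by
      rw [Set.uIcc_of_le htb, Set.uIcc_of_le hbc]; exact Set.Icc_subset_Icc_right ht))]
  exact (dist_triangle _ (f b) _).trans (add_le_add (e₁ s b hs hbs le_rfl) (e₂ b t le_rfl htb ht))

lemma of_halves {f₁ f₂ : ℝ → Y} (hf₁ : ∀ t, t ≤ 1 / 2 → f t = f₁ t)
    (hf₂ : ∀ t, t ≤ 1 / 2 → f (1 - t) = f₂ t) (hd₁ : DistLeIntegral f₁ 0 (1 / 2))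
    (hd₂ : DistLeIntegral f₂ 0 (1 / 2)) : DistLeIntegral f 0 1 := by
  refine (hd₁.congr fun t ht => (hf₁ t ht.2).symm).trans (b := 1 / 2) ?_ (by norm_num)
    (by norm_num)
  have h := hd₂.comp_const_sub 1
  rw [sub_zero, show (1 : ℝ) - 1 / 2 = 1 / 2 by norm_num] at h
  refine h.congr fun t ht => ?_
  have := hf₂ (1 - t) (by linarith [ht.1])
  rw [sub_sub_cancel] at this
  exact this.symm

end DistLeIntegral

lemma AbsolutelyContinuousOnInterval.distLeIntegral_real {f : ℝ → ℝ} {a b : ℝ}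
    (hf : AbsolutelyContinuousOnInterval f a b) : DistLeIntegral f a b := by
  refine ⟨fun r => |deriv f r|, hf.intervalIntegrable_deriv.abs, fun s t hs hst ht => ?_⟩
  have h := (hf.mono (c := s) (d := t) (by
    rw [Set.uIcc_of_le hst, Set.uIcc_of_le (hs.trans (hst.trans ht))]
    exact Set.Icc_subset_Icc hs ht)).integral_deriv_eq_sub
  rw [dist_comm, Real.dist_eq, ← h]
  exact intervalIntegral.abs_integral_le_integral_abs hst

lemma AbsolutelyContinuousOnInterval.distLeIntegral {X : Type*} [MetricSpace X] {γ : ℝ → X}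
    {a b : ℝ} (hab : a ≤ b) (hγ : AbsolutelyContinuousOnInterval γ a b)
    (hfin : ∫⁻ r in Set.Ioo a b, metricSpeed γ r ^ 2 ≠ ⊤) : DistLeIntegral γ a b := by
  have hfin' := lintegral_metricSpeed_ne_top hfin
  refine ⟨fun r => (metricSpeed γ r).toReal, intervalIntegrable_toReal_Ioo hab
    (aemeasurable_metricSpeed hab (hγ.continuousOn_Icc hab)) hfin', fun s t hs hst ht => ?_⟩
  refine dist_le_integral_metricSpeed hst (hγ.mono ?_)
    (ne_top_of_le_ne_top hfin' (lintegral_mono_set (Set.Ioo_subset_Ioo hs ht)))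
  rw [Set.uIcc_of_le hst, Set.uIcc_of_le hab]
  exact Set.Icc_subset_Icc hs ht

lemma lintegral_Ioo_zero_one (f : ℝ → ℝ≥0∞) :
    ∫⁻ r in Set.Ioo (0 : ℝ) 1, f r = (∫⁻ r in Set.Ioo (0 : ℝ) (1 / 2), f r)
      + ∫⁻ r in Set.Ioo (0 : ℝ) (1 / 2), f (1 - r) := by
  have h1 : Set.Ioc (0 : ℝ) 1 = Set.Ioc (0 : ℝ) (1 / 2) ∪ Set.Ioc (1 / 2 : ℝ) 1 :=
    (Set.Ioc_union_Ioc_eq_Ioc (by norm_num) (by norm_num)).symm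
  have h2 : ∫⁻ r in Set.Ioo (0 : ℝ) (1 / 2), f (1 - r) = ∫⁻ r in Set.Ioo (1 / 2 : ℝ) 1, f r := by
    have h3 := (Measure.measurePreserving_sub_left volume (1 : ℝ)).setLIntegral_comp_preimage_emb
      (MeasurableEquiv.subLeft (1 : ℝ)).measurableEmbedding f (Set.Ioo (1 / 2 : ℝ) 1)
    rw [← h3]
    congr 2
    ext r
    simp only [Set.mem_preimage, Set.mem_Ioo]
    constructor <;> intro h <;> constructor <;> linarith [h.1, h.2]
  rw [h2, setLIntegral_congr Ioo_ae_eq_Ioc, h1,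
    lintegral_union measurableSet_Ioc (Set.Ioc_disjoint_Ioc_of_le le_rfl),
    setLIntegral_congr Ioo_ae_eq_Ioc, setLIntegral_congr Ioo_ae_eq_Ioc]

lemma memLp_two_iff_lintegral_sq {f : ℝ → ℝ≥0∞} {μ : Measure ℝ} :
    MemLp f 2 μ ↔ AEMeasurable f μ ∧ ∫⁻ r, f r ^ 2 ∂μ ≠ ⊤ := by
  rw [MemLp, aestronglyMeasurable_iff_aemeasurable]
  refine and_congr_right fun _ => ?_
  rw [eLpNorm_lt_top_iff_lintegral_rpow_enorm_lt_top (by norm_num) (by norm_num), lt_top_iff_ne_top]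
  simp

lemma EReal.coe_ennreal_eq_coe_toReal {a : ℝ≥0∞} (ha : a ≠ ⊤) : (a : EReal) = (a.toReal : ℝ) := by
  lift a to NNReal using ha
  rfl

/-! ### Gluing the estimates for the curve and its reversal at time 1/2 -/

theorem theorem3p8 {X : Type*} [MetricSpace X] [CompleteSpace X]
    [TopologicalSpace.SeparableSpace X] (E : X → EReal) (lam : ℝ) (hE : EVISetting E lam)
    (ε : ℝ) (hε : 0 < ε) (γ : ℝ → X) (hγ : IsAC2 γ) (h0 : E (γ 0) < ⊤) (h1 : E (γ 1) < ⊤) :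
    IsAC2 (regularizedCurve E lam ε γ) ∧
    ((∀ t ∈ Set.Icc (0 : ℝ) 1, E (regularizedCurve E lam ε γ t) < ⊤) ∧
      AbsolutelyContinuousOnInterval
        (fun t => (E (regularizedCurve E lam ε γ t)).toReal) 0 1) ∧
    MemLp (fun t => metricSlope E (regularizedCurve E lam ε γ t)) 2
      (volume.restrict (Set.Ioo (0 : ℝ) 1)) ∧
    ((1 / 2 : ℝ) : EReal) *
          ((∫⁻ t in Set.Ioo (0 : ℝ) 1, metricSpeed (regularizedCurve E lam ε γ) t ^ 2 : ℝ≥0∞) :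
            EReal)
        + ((ε ^ 2 / 2 : ℝ) : EReal) *
          ((∫⁻ t in Set.Ioo (0 : ℝ) 1, metricSlope E (regularizedCurve E lam ε γ t) ^ 2 : ℝ≥0∞) : EReal)
      ≤ ((1 / 2 * Real.exp (max (-lam) 0 * ε) : ℝ) : EReal) *
          ((∫⁻ t in Set.Ioo (0 : ℝ) 1, metricSpeed γ t ^ 2 : ℝ≥0∞) : EReal)
        - ((2 * ε : ℝ) : EReal) * E (regularizedCurve E lam ε γ (1 / 2))
        + (ε : EReal) * (E (γ 0) + E (γ 1)) := by
  obtain ⟨hγac, hγL2⟩ := hγ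
  have hγfin := (memLp_two_iff_lintegral_sq.1 hγL2).2
  set γ' : ℝ → X := fun t => γ (1 - t) with hγ'
  set β := regularizedCurve E lam ε γ with hβ
  have hβ1 : ∀ t, t ≤ 1 / 2 → β t = flowedCurve E lam ε γ t := fun t ht => by
    rw [hβ, regularizedCurve, flowedCurve, min_eq_left (by linarith)]
  have hβ2 : ∀ t, t ≤ 1 / 2 → β (1 - t) = flowedCurve E lam ε γ' t := fun t ht => by
    rw [hβ, regularizedCurve, flowedCurve, min_eq_right (by linarith), sub_sub_cancel]
  have hγD := hγac.distLeIntegral zero_le_one hγfin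
  have hγD' : DistLeIntegral γ' 0 1 := by simpa using hγD.comp_const_sub 1
  have hsub : Set.uIcc (0 : ℝ) (1 / 2) ⊆ Set.uIcc 0 1 := by
    rw [Set.uIcc_of_le (by norm_num), Set.uIcc_of_le (by norm_num)]
    exact Set.Icc_subset_Icc_right (by norm_num)
  have hsplitγ : ∫⁻ r in Set.Ioo (0 : ℝ) 1, metricSpeed γ r ^ 2 =
      (∫⁻ r in Set.Ioo (0 : ℝ) (1 / 2), metricSpeed γ r ^ 2)
        + ∫⁻ r in Set.Ioo (0 : ℝ) (1 / 2), metricSpeed γ' r ^ 2 := by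
    rw [lintegral_Ioo_zero_one]
    simp only [hγ', metricSpeed_comp_const_sub]
  have hfin := hγfin
  rw [hsplitγ] at hfin
  have hfin1 := ne_top_of_le_ne_top hfin le_self_add
  have hfin2 := ne_top_of_le_ne_top hfin le_add_self
  have h0' : E (γ' 0) < ⊤ := by simpa [hγ'] using h1
  have hac1 := hγac.mono hsub
  have hac2 := (hγD'.absolutelyContinuousOnInterval zero_le_one).mono hsub
  obtain ⟨hA1, hM1, hS1, hI1⟩ := flowedCurve_estimate hE hε h0 (by norm_num) hac1 hfin1
  obtain ⟨hA2, hM2, hS2, hI2⟩ := flowedCurve_estimate hE hε h0' (by norm_num) hac2 hfin2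
  have hF1 := absolutelyContinuousOnInterval_energy hE hε h0 (by norm_num) hac1 hfin1
  have hF2 := absolutelyContinuousOnInterval_energy hE hε h0' (by norm_num) hac2 hfin2
  -- Both halves are put in the integral form `DistLeIntegral`, which is stable under reversal and
  -- concatenation.
  have hβac : AbsolutelyContinuousOnInterval β 0 1 :=
    (DistLeIntegral.of_halves (f := β) hβ1 hβ2 (hA1.distLeIntegral (by norm_num) hM1)
      (hA2.distLeIntegral (by norm_num) hM2)).absolutelyContinuousOnInterval zero_le_one
  have hFac : AbsolutelyContinuousOnInterval (fun t => (E (β t)).toReal) 0 1 :=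
    (DistLeIntegral.of_halves (f := fun t => (E (β t)).toReal)
      (f₁ := fun t => (E (flowedCurve E lam ε γ t)).toReal)
      (f₂ := fun t => (E (flowedCurve E lam ε γ' t)).toReal) (fun t ht => by simp only [hβ1 t ht])
      (fun t ht => by simp only [hβ2 t ht]) hF1.distLeIntegral_real
      hF2.distLeIntegral_real).absolutelyContinuousOnInterval zero_le_one
  have hβtop : ∀ t ∈ Set.Icc (0 : ℝ) 1, E (β t) < ⊤ := by
    intro t ht
    rcases le_total t (1 / 2) with h | h
    · rw [hβ1 t h]; exact flowedCurve_lt_top hE hε h0 ht.1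
    · have h2 := hβ2 (1 - t) (by linarith)
      rw [sub_sub_cancel] at h2
      rw [h2]; exact flowedCurve_lt_top hE hε h0' (by linarith [ht.2])
  have hβc := hβac.continuousOn_Icc zero_le_one
  have hsplitM : ∫⁻ r in Set.Ioo (0 : ℝ) 1, metricSpeed β r ^ 2 =
      (∫⁻ r in Set.Ioo (0 : ℝ) (1 / 2), metricSpeed (flowedCurve E lam ε γ) r ^ 2)
        + ∫⁻ r in Set.Ioo (0 : ℝ) (1 / 2), metricSpeed (flowedCurve E lam ε γ') r ^ 2 := by
    rw [lintegral_Ioo_zero_one]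
    congr 1
    · refine setLIntegral_congr_fun measurableSet_Ioo fun r hr => ?_
      have : β =ᶠ[𝓝 r] flowedCurve E lam ε γ := by
        filter_upwards [gt_mem_nhds hr.2] with s hs using hβ1 s (le_of_lt hs)
      simp only [metricSpeed_congr this]
    · refine setLIntegral_congr_fun measurableSet_Ioo fun r hr => ?_
      have : (fun s => β (1 - s)) =ᶠ[𝓝 r] flowedCurve E lam ε γ' := by
        filter_upwards [gt_mem_nhds hr.2] with s hs using hβ2 s (le_of_lt hs)
      simp only [← metricSpeed_comp_const_sub, metricSpeed_congr this]
  have hsplitS : ∫⁻ r in Set.Ioo (0 : ℝ) 1, metricSlope E (β r) ^ 2 =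
      (∫⁻ r in Set.Ioo (0 : ℝ) (1 / 2), metricSlope E (flowedCurve E lam ε γ r) ^ 2)
        + ∫⁻ r in Set.Ioo (0 : ℝ) (1 / 2), metricSlope E (flowedCurve E lam ε γ' r) ^ 2 := by
    rw [lintegral_Ioo_zero_one]
    congr 1
    · exact setLIntegral_congr_fun measurableSet_Ioo fun r hr => by simp only [hβ1 r hr.2.le]
    · exact setLIntegral_congr_fun measurableSet_Ioo fun r hr => by simp only [hβ2 r hr.2.le]
  have hM : ∫⁻ r in Set.Ioo (0 : ℝ) 1, metricSpeed β r ^ 2 ≠ ⊤ := by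
    rw [hsplitM]; exact ENNReal.add_ne_top.2 ⟨hM1, hM2⟩
  have hS : ∫⁻ r in Set.Ioo (0 : ℝ) 1, metricSlope E (β r) ^ 2 ≠ ⊤ := by
    rw [hsplitS]; exact ENNReal.add_ne_top.2 ⟨hS1, hS2⟩
  refine ⟨⟨hβac, memLp_two_iff_lintegral_sq.2 ⟨aemeasurable_metricSpeed zero_le_one hβc, hM⟩⟩,
    ⟨hβtop, hFac⟩, memLp_two_iff_lintegral_sq.2
      ⟨aemeasurable_metricSlope_comp hE.lsc hE.ne_bot zero_le_one hβc hβtop, hS⟩, ?_⟩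
  -- Every term is finite, so the inequality reduces to half the sum of the two real estimates `hI1`
  -- and `hI2`.
  rw [EReal.coe_ennreal_eq_coe_toReal hM, EReal.coe_ennreal_eq_coe_toReal hS,
    EReal.coe_ennreal_eq_coe_toReal hγfin,
    ← EReal.coe_toReal (hβtop (1 / 2) ⟨by norm_num, by norm_num⟩).ne (hE.ne_bot _),
    ← EReal.coe_toReal h0.ne (hE.ne_bot _), ← EReal.coe_toReal h1.ne (hE.ne_bot _)]
  norm_cast
  rw [hsplitM, hsplitS, hsplitγ, ENNReal.toReal_add hM1 hM2, ENNReal.toReal_add hS1 hS2,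
    ENNReal.toReal_add hfin1 hfin2]
  have hmid1 := hβ1 (1 / 2) le_rfl
  have hmid2 := hβ2 (1 / 2) le_rfl
  rw [show (1 : ℝ) - 1 / 2 = 1 / 2 by norm_num] at hmid2
  rw [← hmid1] at hI1
  rw [← hmid2] at hI2
  rw [show 2 * max (-lam) 0 * (ε * (1 / 2)) = max (-lam) 0 * ε by ring] at hI1 hI2
  have h10 : γ' 0 = γ 1 := by simp [hγ']
  rw [h10] at hI2
  linarith
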